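/- Let $d\ge 1$, let $\beta\ge 0$, and let $(J_{x,y})_{x,y\in\mathbb Z^d}$ be real coupling constants, $J_{x,y}=J_{y,x}$, which satisfy **C1** $J_{x,y}=J_{0,y-x}$; **C2** $J_{x,y}\ge 0$; **C3** $\sum_{x\in\mathbb Z^d}J_{0,x}<\infty$; **C4** for every $x\in\mathbb Z^d$ there are $0=x_0,x_1,\dots,x_m=x$ in $\mathbb Z^d$ with $J_{x_0,x_1}J_{x_1,x_2}\cdots J_{x_{m-1},x_m}>0$. For finite $\Lambda\subset\mathbb Z^d$ and $\tau\in\{-1,0,1\}^{\mathbb Z^d\setminus\Lambda}$ let $\langle\cdot\rangle^{\tau}_{\Lambda,\beta}$ be the Gibbs state on $\{-1,1\}^\Lambda$ with weights proportional to $e^{-\beta H^\tau_\Lambda(\sigma)}$, where $$H^\tau_\Lambda(\sigma)=-\sum_{\{x,y\}\subset\Lambda,\,x\ne y}J_{x,y}\sigma_x\sigma_y-\sum_{x\in\Lambda,\,y\notin\Lambda}J_{x,y}\sigma_x\tau_y .$$ There are unique probability measures $\langle\cdot\rangle^+_\beta$ (plus state) and $\langle\cdot\rangle^0_\beta$ (free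 state) on $\{-1,1\}^{\mathbb Z^d}$ such that, for every local function $f$ (one which depends on finitely many spins), $\langle f\rangle^{\tau}_{\Lambda,\beta}$ converges, as $\Lambda\uparrow\mathbb Z^d$ through the finite subsets ordered by inclusion, to $\langle f\rangle^+_\beta$ when $\tau\equiv 1$ and to $\langle f\rangle^0_\beta$ when $\tau\equiv 0$. Write $(\tau_x\sigma)_y=\sigma_{y+x}$ for the translations. Then: 1. The plus state is mixing and ergodic: for all local functions $F,G:\{-1,1\}^{\mathbb Z^d}\to\mathbb R$, $$\lim_{\|x\|\to\infty}\langle F\times G\circ\tau_x\rangle^+_\beta=\langle F\rangle^+_\beta\,\langle G\rangle^+_\beta ;$$ for all measurable events $A,B$ the probability of $A\cap\tau_x^{-1}B$ tends to the product of the probabilities of $A$ and $B$ as $\|x\|\to\infty$; and the state is translation invariant and gives probability $0$ or $1$ to every translation invariant event. 2. The free state is mixing and ergodic in its restriction to the $\sigma$-algebra of even events, that is, of the measurable events invariant under the global spin flip $\sigma\mapsto-\sigma$: for all local functions $F,G$ with $F(-\sigma)=F(\sigma)$ and $G(-\sigma)=G(\sigma)$, $$\lim_{\|x\|\to\infty}\langle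 F\times G\circ\tau_x\rangle^0_\beta=\langle F\rangle^0_\beta\,\langle G\rangle^0_\beta ;$$ for all even events $A,B$ the probability of $A\cap\tau_x^{-1}B$ tends to the product of the probabilities of $A$ and $B$ as $\|x\|\to\infty$; and the state is translation invariant and gives probability $0$ or $1$ to every translation invariant even event. -/

import Mathlib

open Filter Topology MeasureTheory

/-- The lattice `ℤ^d`. -/
abbrev Site (d : ℕ) : Type := Fin d → ℤ

/-- Spin configurations `σ ∈ {-1, 1}^{ℤ^d}`, with the product σ-algebra; `ℤˣ = {1, -1}`. -/
abbrev Config (d : ℕ) : Type := Site d → ℤˣ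

/-- The real value `±1` of a spin. -/
def spin (s : ℤˣ) : ℝ := ((s : ℤ) : ℝ)

/-- The standing conditions on the coupling constants. The coupling constants belong to unordered
pairs of sites, which is recorded by `symm`. -/
structure IsFerromagnetic {d : ℕ} (J : Site d → Site d → ℝ) : Prop where
  symm : ∀ x y, J x y = J y x
  translation_invariant : ∀ x y, J x y = J 0 (y - x)
  nonneg : ∀ x y, 0 ≤ J x y
  locally_finite : Summable fun x => J 0 x
  aperiodic : ∀ x, ∃ (m : ℕ) (p : ℕ → Site d), p 0 = 0 ∧ p m = x ∧
    0 < ∏ i ∈ Finset.range m, J (p i) (p (i + 1))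

/-- The Hamiltonian in the finite volume `Λ`, with magnetic field `h` and boundary condition
`τ ∈ {-1, 0, 1}`, of which only the values outside `Λ` are used. The second sum runs over ordered
pairs of distinct sites of `Λ`, so the factor `1/2` counts every unordered pair once. -/
noncomputable def hamiltonian {d : ℕ} (J : Site d → Site d → ℝ) (h : ℝ) (τ : Site d → SignType)
    (Λ : Finset (Site d)) (σ : Λ → ℤˣ) : ℝ :=
  - (∑ x : Λ, h * spin (σ x))
  - (1 / 2) * (∑ x : Λ, ∑ y : Λ, if x ≠ y then J x y * spin (σ x) * spin (σ y) else 0)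
  - ∑ x : Λ, ∑' y : {y : Site d // y ∉ Λ}, J x y * spin (σ x) * ((τ y : SignType) : ℝ)

/-- Extension of a configuration in `Λ` to the whole lattice by the value `1`. It serves only to
evaluate functions on `Config d`; it is immaterial for functions of the spins in `Λ`. -/
def extend {d : ℕ} (Λ : Finset (Site d)) (σ : Λ → ℤˣ) : Config d :=
  fun x => if hx : x ∈ Λ then σ ⟨x, hx⟩ else 1

/-- The partition function. -/
noncomputable def partitionFunction {d : ℕ} (J : Site d → Site d → ℝ) (β h : ℝ)
    (τ : Site d → SignType) (Λ : Finset (Site d)) : ℝ :=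
  ∑ σ : Λ → ℤˣ, Real.exp (-β * hamiltonian J h τ Λ σ)

/-- The expectation of `f` in the finite volume Gibbs state in `Λ`. -/
noncomputable def finiteGibbs {d : ℕ} (J : Site d → Site d → ℝ) (β h : ℝ)
    (τ : Site d → SignType) (Λ : Finset (Site d)) (f : Config d → ℝ) : ℝ :=
  ∑ σ : Λ → ℤˣ, f (extend Λ σ) *
    (Real.exp (-β * hamiltonian J h τ Λ σ) / partitionFunction J β h τ Λ)

/-- Local functions: those which depend on finitely many spins. -/
def IsLocal {d : ℕ} (f : Config d → ℝ) : Prop :=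
  ∃ A : Finset (Site d), DependsOn f (A : Set (Site d))

/-- `μ` is the infinite volume limit of the finite volume Gibbs states with boundary condition `τ`:
as `Λ` increases to the whole lattice through its finite subsets, the expectations of local
functions converge to those under `μ`. -/
def IsInfiniteVolumeState {d : ℕ} (J : Site d → Site d → ℝ) (β h : ℝ) (τ : Site d → SignType)
    (μ : ProbabilityMeasure (Config d)) : Prop :=
  ∀ f : Config d → ℝ, IsLocal f →
    Tendsto (fun Λ : Finset (Site d) => finiteGibbs J β h τ Λ f) atTop
      (𝓝 (∫ σ, f σ ∂(μ : Measure (Config d))))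

/-- The state with plus boundary conditions, at zero magnetic field. -/
def IsPlusState {d : ℕ} (J : Site d → Site d → ℝ) (β : ℝ)
    (μ : ProbabilityMeasure (Config d)) : Prop :=
  IsInfiniteVolumeState J β 0 (fun _ => 1) μ

/-- The state with free boundary conditions, at zero magnetic field. -/
def IsFreeState {d : ℕ} (J : Site d → Site d → ℝ) (β : ℝ)
    (μ : ProbabilityMeasure (Config d)) : Prop :=
  IsInfiniteVolumeState J β 0 (fun _ => 0) μ

/-- The translation `(τ_x σ)_y = σ_{y + x}`. -/
def shift {d : ℕ} (x : Site d) (σ : Config d) : Config d := fun y => σ (y + x)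

/-- The filter `‖x‖ → ∞` on `ℤ^d`. -/
def atInfinity (d : ℕ) : Filter (Site d) := comap (fun x : Site d => ‖x‖) atTop

/-- Even functions: invariant under the global spin flip. -/
def IsEven {d : ℕ} (F : Config d → ℝ) : Prop := ∀ σ, F (-σ) = F σ

/-- The σ-algebra of even events: measurable sets invariant under the global spin flip. -/
def evenEvents (d : ℕ) : Set (Set (Config d)) :=
  {A | MeasurableSet[MeasurableSpace.invariants (fun σ : Config d => -σ)] A}

/-- `⟨F × G ∘ τ_x⟩ → ⟨F⟩ ⟨G⟩` as `‖x‖ → ∞`, for all `F` and `G` in the class `C`. -/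
def IsMixingFor {d : ℕ} (μ : ProbabilityMeasure (Config d)) (C : Set (Config d → ℝ)) : Prop :=
  ∀ F ∈ C, ∀ G ∈ C,
    Tendsto (fun x : Site d => ∫ σ, F σ * G (shift x σ) ∂(μ : Measure (Config d))) (atInfinity d)
      (𝓝 ((∫ σ, F σ ∂(μ : Measure (Config d))) * ∫ σ, G σ ∂(μ : Measure (Config d))))

/-- Mixing on a family `𝒜` of events: `μ (A ∩ τ_x⁻¹ B) → μ A * μ B` as `‖x‖ → ∞`, for `A` and `B`
in `𝒜`. -/
def IsMixingOn {d : ℕ} (μ : ProbabilityMeasure (Config d)) (𝒜 : Set (Set (Config d))) : Prop :=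
  ∀ A ∈ 𝒜, ∀ B ∈ 𝒜,
    Tendsto (fun x : Site d => (μ : Measure (Config d)) (A ∩ shift x ⁻¹' B)) (atInfinity d)
      (𝓝 ((μ : Measure (Config d)) A * (μ : Measure (Config d)) B))

/-- Ergodicity on a family `𝒜` of events: `μ` is translation invariant, and the events of `𝒜` which
are invariant under all translations have probability `0` or `1`. -/
def IsErgodicOn {d : ℕ} (μ : ProbabilityMeasure (Config d)) (𝒜 : Set (Set (Config d))) : Prop :=
  (∀ x : Site d, MeasurePreserving (shift x) (μ : Measure (Config d)) (μ : Measure (Config d))) ∧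
  ∀ A ∈ 𝒜, (∀ x : Site d, shift x ⁻¹' A = A) →
    (μ : Measure (Config d)) A = 0 ∨ (μ : Measure (Config d)) A = 1

/-!
Configurations form a compact group under pointwise multiplication, and a finite volume Gibbs state
is its Haar measure tilted by an energy. Integration against Haar measure is nonnegative on the cone
`posCone` spanned by products of spins; this is Griffiths' first inequality, and its version on the
doubled group, written with the translations of the group, is the second: expectations of functions
in the cone are positively correlated, and increase with the energy.

For the plus state, local functions are spanned by the indicators `plusIndicator A` of the events
that all spins in `A` are plus. Write `P_A` for this indicator. Positive correlation bounds
`⟨P_A · P_B ∘ τ_x⟩` from below by `⟨P_A⟩ ⟨P_B⟩`. For the upper bound, let `V` be a volume which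
contains `B`, and let `A` lie outside its translate: imposing plus spins on everything outside the
translate of `V`, in particular on `A`, only increases the conditional expectation of `P_B ∘ τ_x`,
and replaces it by `⟨P_B⟩` in the volume `V` with plus boundary condition. Let first `x → ∞` and
then `V` increase to the whole lattice.

For the free state with `β ≠ 0`, even local functions are spanned by the factors
`D_S = bondRemoval K S`, which erase the bonds in `S` from the Gibbs weight: products of two spins
joined by a bond are combinations of such factors, and bonds connect all sites. The ratio
`⟨D_S · D_T ∘ τ_x⟩ / ⟨D_S⟩` is the expectation of `D_T ∘ τ_x` once the bonds in `S` are erased, and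
this expectation decreases as further bonds are added. Restoring the bonds in `S` gives the lower
bound `⟨D_T ∘ τ_x⟩`, and erasing all bonds outside the translate of a volume `V` which contains the
bonds of `T` gives the upper bound `⟨D_T⟩` in the volume `V` with free boundary condition.

Events are approximated by cylinders, even events by even cylinders, and a translation invariant
event `A` satisfies `μ A = μ A * μ A` by mixing.
-/

open scoped NNReal

section Spin

lemma spin_one : spin 1 = 1 := by simp [spin]

lemma spin_mul (a b : ℤˣ) : spin (a * b) = spin a * spin b := by simp [spin]

lemma spin_neg (a : ℤˣ) : spin (-a) = -spin a := by simp [spin]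

lemma spin_eq_one_or (a : ℤˣ) : spin a = 1 ∨ spin a = -1 := by
  rcases Int.units_eq_one_or a with rfl | rfl <;> simp [spin]

lemma spin_mul_self (a : ℤˣ) : spin a * spin a = 1 := by
  rcases spin_eq_one_or a with h | h <;> simp [h]

lemma neg_one_le_spin (a : ℤˣ) : -1 ≤ spin a := by
  rcases spin_eq_one_or a with h | h <;> simp [h]

lemma exp_mul_spin (c : ℝ) (a : ℤˣ) :
    Real.exp (c * spin a) = Real.cosh c + Real.sinh c * spin a := by
  rcases spin_eq_one_or a with h | h
  · rw [h, mul_one, mul_one, Real.cosh_add_sinh]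
  · rw [h, mul_neg_one, mul_neg_one, ← sub_eq_add_neg, Real.cosh_sub_sinh]

@[fun_prop]
lemma continuous_spin : Continuous spin := continuous_of_discreteTopology

instance instBorelSpaceIntUnits : BorelSpace ℤˣ where
  measurable_eq := by
    rw [borel_eq_top_of_discrete]
    exact top_le_iff.1 fun s _ =>
      ⟨Units.val '' s, trivial, Set.preimage_image_eq s Units.val_injective⟩

end Spin

section PosCone

variable {G : Type*} [CommGroup G] [TopologicalSpace G]

/-- A continuous character `χ : G → {1, -1}` as a real function. -/
def spinChar (χ : G →ₜ* ℤˣ) : C(G, ℝ) := ⟨fun σ => spin (χ σ), by fun_prop⟩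

lemma spinChar_apply (χ : G →ₜ* ℤˣ) (σ : G) : spinChar χ σ = spin (χ σ) := rfl

lemma spinChar_one : spinChar (1 : G →ₜ* ℤˣ) = 1 := ContinuousMap.ext fun _ => spin_one

lemma spinChar_mul (χ ψ : G →ₜ* ℤˣ) : spinChar (χ * ψ) = spinChar χ * spinChar ψ :=
  ContinuousMap.ext fun _ => spin_mul _ _

variable (G) in
/-- The positive combinations of products of characters `G → {1, -1}`: the class of functions of
Griffiths' inequalities. -/
def posCone : Subalgebra ℝ≥0 C(G, ℝ) := Algebra.adjoin ℝ≥0 (Set.range spinChar)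

lemma spinChar_mem_posCone (χ : G →ₜ* ℤˣ) : spinChar χ ∈ posCone G :=
  Algebra.subset_adjoin ⟨χ, rfl⟩

lemma smul_mem_posCone {c : ℝ} (hc : 0 ≤ c) {f : C(G, ℝ)} (hf : f ∈ posCone G) :
    c • f ∈ posCone G :=
  (posCone G).smul_mem hf ⟨c, hc⟩

@[elab_as_elim]
lemma posCone_induction {p : C(G, ℝ) → Prop} (zero : p 0)
    (add : ∀ f g, p f → p g → p (f + g))
    (smul_spinChar : ∀ c : ℝ, 0 ≤ c → ∀ χ, p (c • spinChar χ)) {f : C(G, ℝ)}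
    (hf : f ∈ posCone G) : p f := by
  let charHom : (G →ₜ* ℤˣ) →* C(G, ℝ) := ⟨⟨spinChar, spinChar_one⟩, spinChar_mul⟩
  have hspan : (posCone G).toSubmodule = Submodule.span ℝ≥0 (Set.range spinChar) := by
    rw [posCone, Algebra.adjoin_eq_span,
      show Set.range spinChar = (MonoidHom.mrange charHom : Set _) from rfl, Submonoid.closure_eq]
  rw [← Subalgebra.mem_toSubmodule, hspan] at hf
  induction hf using Submodule.closure_induction with
  | zero => exact zero
  | add f g _ _ hf hg => exact add f g hf hg
  | smul_mem c _ hχ =>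
    obtain ⟨χ, rfl⟩ := hχ
    exact smul_spinChar c c.2 χ

/-- The indicator function of the set where the character `χ` takes the value `1`. -/
noncomputable def charIndicator (χ : G →ₜ* ℤˣ) : C(G, ℝ) := (2⁻¹ : ℝ) • (1 + spinChar χ)

lemma charIndicator_apply (χ : G →ₜ* ℤˣ) (σ : G) :
    charIndicator χ σ = if χ σ = 1 then 1 else 0 := by
  rcases Int.units_eq_one_or (χ σ) with h | h <;>
    norm_num [charIndicator, spinChar_apply, h, spin_one, spin_neg, Units.ext_iff]

lemma charIndicator_mem_posCone (χ : G →ₜ* ℤˣ) : charIndicator χ ∈ posCone G :=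
  smul_mem_posCone (by norm_num) (add_mem (one_mem _) (spinChar_mem_posCone χ))

section Translate

variable [ContinuousMul G]

/-- The translate `σ ↦ f (σ * t)`. -/
def mulTranslate (t : G) (f : C(G, ℝ)) : C(G, ℝ) := f.comp (ContinuousMap.mulRight t)

lemma mulTranslate_apply (t : G) (f : C(G, ℝ)) (σ : G) : mulTranslate t f σ = f (σ * t) := rfl

lemma mulTranslate_mul (t : G) (f g : C(G, ℝ)) :
    mulTranslate t (f * g) = mulTranslate t f * mulTranslate t g := rfl

lemma add_smul_mulTranslate_mem_posCone {f : C(G, ℝ)} (hf : f ∈ posCone G) (a : ℤˣ) (t : G) :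
    f + spin a • mulTranslate t f ∈ posCone G := by
  refine posCone_induction ?_ (fun f g hf hg => ?_) (fun c hc χ => ?_) hf
  · convert zero_mem (posCone G)
    ext
    simp [mulTranslate_apply]
  · convert add_mem hf hg using 1
    ext
    simp only [mulTranslate_apply, ContinuousMap.add_apply, ContinuousMap.smul_apply, smul_eq_mul]
    ring
  · have hcoeff : 0 ≤ c * (1 + spin (a * χ t)) :=
      mul_nonneg hc (by linarith [neg_one_le_spin (a * χ t)])
    convert smul_mem_posCone hcoeff (spinChar_mem_posCone χ) using 1
    ext
    simp only [mulTranslate_apply, ContinuousMap.add_apply, ContinuousMap.smul_apply, smul_eq_mul,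
      spinChar_apply, map_mul, spin_mul]
    ring

end Translate

/-- The Boltzmann weight `exp E` of the energy `E` (with the sign convention in which large values
of `E` are favoured). -/
noncomputable def boltzmann {X : Type*} [TopologicalSpace X] (E : C(X, ℝ)) : C(X, ℝ) :=
  ⟨fun σ => Real.exp (E σ), by fun_prop⟩

lemma boltzmann_add {X : Type*} [TopologicalSpace X] (E F : C(X, ℝ)) :
    boltzmann (E + F) = boltzmann E * boltzmann F :=
  ContinuousMap.ext fun _ => Real.exp_add _ _

lemma boltzmann_mem_posCone {E : C(G, ℝ)} (hE : E ∈ posCone G) : boltzmann E ∈ posCone G := by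
  refine posCone_induction ?_ (fun E F hE hF => ?_) (fun c hc χ => ?_) hE
  · convert one_mem (posCone G)
    ext
    simp [boltzmann]
  · rw [boltzmann_add]
    exact mul_mem hE hF
  · have heq : boltzmann (c • spinChar χ) = Real.cosh c • 1 + Real.sinh c • spinChar χ := by
      ext
      simp [boltzmann, spinChar_apply, exp_mul_spin]
    rw [heq]
    exact add_mem (smul_mem_posCone (Real.cosh_pos c).le (one_mem _))
      (smul_mem_posCone (Real.sinh_nonneg_iff.2 hc) (spinChar_mem_posCone χ))

variable [ContinuousMul G]

variable (G) in
/-- The weights `w` to which Griffiths' second inequality applies: for every `t`, the function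
`σ ↦ w σ * w (σ * t)` lies in the positive cone. -/
def ferromagneticWeights : Submonoid C(G, ℝ) where
  carrier := {w | ∀ t, w * mulTranslate t w ∈ posCone G}
  one_mem' _ := by convert one_mem (posCone G); ext; simp [mulTranslate_apply]
  mul_mem' hv hw t := by
    rw [mulTranslate_mul, mul_mul_mul_comm]
    exact mul_mem (hv t) (hw t)

lemma boltzmann_mem_ferromagneticWeights {E : C(G, ℝ)} (hE : E ∈ posCone G) :
    boltzmann E ∈ ferromagneticWeights G := fun t => by
  have hE' : E + mulTranslate t E ∈ posCone G := by
    simpa [spin_one] using add_smul_mulTranslate_mem_posCone hE 1 t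
  have := boltzmann_mem_posCone hE'
  rwa [boltzmann_add] at this

lemma charIndicator_mem_ferromagneticWeights (χ : G →ₜ* ℤˣ) :
    charIndicator χ ∈ ferromagneticWeights G := fun t => by
  by_cases ht : χ t = 1
  · convert charIndicator_mem_posCone χ using 1
    ext
    simp [mulTranslate_apply, charIndicator_apply, ht]
  · convert zero_mem (posCone G)
    ext σ
    simp only [ContinuousMap.mul_apply, mulTranslate_apply, charIndicator_apply, map_mul,
      ContinuousMap.zero_apply]
    by_cases hσ : χ σ = 1 <;> simp [hσ, ht]

end PosCone

section Griffiths

lemma integrable_continuousMap {X : Type*} [TopologicalSpace X] [CompactSpace X]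
    [MeasurableSpace X] [OpensMeasurableSpace X] (μ : Measure X) [IsFiniteMeasure μ]
    (f : C(X, ℝ)) : Integrable f μ :=
  f.continuous.integrable_of_hasCompactSupport (.of_compactSpace f)

lemma integral_boltzmann_pos {X : Type*} [TopologicalSpace X] [CompactSpace X]
    [MeasurableSpace X] [OpensMeasurableSpace X] (μ : ProbabilityMeasure X) (E : C(X, ℝ)) :
    0 < ∫ σ, boltzmann E σ ∂μ :=
  integral_exp_pos (integrable_continuousMap _ (boltzmann E))

variable {G : Type*} [CommGroup G] [TopologicalSpace G] [IsTopologicalGroup G]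
  [MeasurableSpace G] [BorelSpace G]

section Invariant

variable (μ : Measure G) [μ.IsMulLeftInvariant]

lemma integral_spinChar_nonneg (χ : G →ₜ* ℤˣ) : 0 ≤ ∫ σ, spinChar χ σ ∂μ := by
  by_cases htriv : ∀ t, χ t = 1
  · exact integral_nonneg fun σ => by simp [spinChar_apply, htriv, spin_one]
  · obtain ⟨t, ht⟩ := not_forall.1 htriv
    have hflip : ∫ σ, spinChar χ σ ∂μ = -∫ σ, spinChar χ σ ∂μ := by
      conv_lhs => rw [← integral_mul_left_eq_self _ t]
      simp [spinChar_apply, Int.units_ne_iff_eq_neg.1 ht, spin_neg, integral_neg]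
    linarith

variable [CompactSpace G] [IsFiniteMeasure μ]

lemma integral_nonneg_of_mem_posCone {f : C(G, ℝ)} (hf : f ∈ posCone G) : 0 ≤ ∫ σ, f σ ∂μ := by
  refine posCone_induction ?_ (fun f g hf hg => ?_) (fun c hc χ => ?_) hf
  · simp
  · simp only [ContinuousMap.add_apply]
    rw [integral_add (integrable_continuousMap μ f) (integrable_continuousMap μ g)]
    exact add_nonneg hf hg
  · simp only [ContinuousMap.smul_apply, smul_eq_mul, integral_const_mul]
    exact mul_nonneg hc (integral_spinChar_nonneg μ χ)

lemma integral_charIndicator_mul {χ : G →ₜ* ℤˣ} {t : G} (ht : χ t = -1) {f : C(G, ℝ)}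
    (hf : mulTranslate t f = f) :
    ∫ σ, (charIndicator χ * f) σ ∂μ = 2⁻¹ * ∫ σ, f σ ∂μ := by
  have hflip : ∫ σ, (spinChar χ * f) σ ∂μ = -∫ σ, (spinChar χ * f) σ ∂μ := by
    have hft (σ : G) : f (t * σ) = f σ := mul_comm σ t ▸ DFunLike.congr_fun hf σ
    conv_lhs => rw [← integral_mul_left_eq_self _ t]
    simp [spinChar_apply, ht, spin_neg, integral_neg, hft]
  have hsplit : charIndicator χ * f = (2⁻¹ : ℝ) • (f + spinChar χ * f) := by
    rw [charIndicator, smul_mul_assoc, add_mul, one_mul]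
  simp only [hsplit, ContinuousMap.smul_apply, ContinuousMap.add_apply, smul_eq_mul,
    integral_const_mul]
  rw [integral_add (integrable_continuousMap μ _) (integrable_continuousMap μ _)]
  linarith

lemma integral_mul_integral_eq_integral_mulTranslate (f g : C(G, ℝ)) :
    (∫ σ, f σ ∂μ) * ∫ σ, g σ ∂μ = ∫ t, ∫ σ, (f * mulTranslate t g) σ ∂μ ∂μ := by
  have hcont : Continuous fun p : G × G => f p.2 * g (p.2 * p.1) := by fun_prop
  calc (∫ σ, f σ ∂μ) * ∫ σ, g σ ∂μ
      = ∫ σ, ∫ t, f σ * g (σ * t) ∂μ ∂μ := by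
        simp only [integral_const_mul, integral_mul_left_eq_self (μ := μ) (fun t => g t),
          integral_mul_const]
    _ = ∫ t, ∫ σ, f σ * g (σ * t) ∂μ ∂μ :=
        (integral_integral_swap_of_hasCompactSupport hcont (.of_compactSpace _)).symm

/-- Griffiths' second inequality. -/
theorem integral_mul_integral_le_of_ferromagnetic {f g w : C(G, ℝ)} (hf : f ∈ posCone G)
    (hg : g ∈ posCone G) (hw : w ∈ ferromagneticWeights G) :
    (∫ σ, (f * w) σ ∂μ) * ∫ σ, (g * w) σ ∂μ ≤ (∫ σ, (f * g * w) σ ∂μ) * ∫ σ, w σ ∂μ := by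
  rw [integral_mul_integral_eq_integral_mulTranslate,
    integral_mul_integral_eq_integral_mulTranslate]
  have hint (u v : C(G, ℝ)) : Integrable (fun t => ∫ σ, (u * mulTranslate t v) σ ∂μ) μ := by
    have hcont : Continuous fun p : G × G => u p.2 * v (p.2 * p.1) := by fun_prop
    exact integrable_continuousMap μ ⟨_, continuousOn_univ.1 <|
      continuousOn_integral_of_compact_support (f := fun t σ => u σ * v (σ * t)) isCompact_univ
        hcont.continuousOn fun _ σ _ hσ => (hσ (Set.mem_univ σ)).elim⟩
  refine integral_mono (hint _ _) (hint _ _) fun t => ?_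
  have hdiff : g - mulTranslate t g ∈ posCone G := by
    simpa [spin_neg, spin_one, sub_eq_add_neg] using add_smul_mulTranslate_mem_posCone hg (-1) t
  have hcone : f * g * w * mulTranslate t w - f * w * mulTranslate t (g * w) ∈ posCone G := by
    convert mul_mem (mul_mem hf hdiff) (hw t) using 1
    rw [mulTranslate_mul]
    ring
  have := integral_nonneg_of_mem_posCone μ hcone
  simp only [ContinuousMap.sub_apply] at this
  rwa [integral_sub (integrable_continuousMap μ _) (integrable_continuousMap μ _),
    sub_nonneg] at this

end Invariant

section GibbsMeasure

variable [CompactSpace G]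

variable (G) in
/-- The normalised Haar measure, which is the law of independent unbiased spins when `G` is a power
of `{1, -1}`. -/
noncomputable def haarProb : ProbabilityMeasure G :=
  ⟨Measure.haarMeasure ⊤, ⟨Measure.haarMeasure_self⟩⟩

instance : (haarProb G : Measure G).IsHaarMeasure :=
  inferInstanceAs (Measure.haarMeasure ⊤).IsHaarMeasure

/-- The Gibbs measure with density proportional to `exp E` with respect to `haarProb G`. -/
noncomputable def gibbs (E : C(G, ℝ)) : ProbabilityMeasure G :=
  ⟨(haarProb G : Measure G).tilted E,
    isProbabilityMeasure_tilted (integrable_continuousMap _ (boltzmann E))⟩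

variable {E F f g w : C(G, ℝ)}

lemma integral_gibbs (E f : C(G, ℝ)) :
    ∫ σ, f σ ∂(gibbs E) =
      (∫ σ, (f * boltzmann E) σ ∂(haarProb G)) / ∫ σ, boltzmann E σ ∂(haarProb G) := by
  refine (integral_tilted _ _).trans ?_
  rw [← integral_div]
  refine integral_congr_ae (.of_forall fun σ => ?_)
  simp only [boltzmann, ContinuousMap.coe_mk, ContinuousMap.mul_apply, smul_eq_mul]
  ring

lemma integral_gibbs_pos (E : C(G, ℝ)) (hf : 0 ≤ f) {τ : G} (hτ : f τ ≠ 0) :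
    0 < ∫ σ, f σ ∂(gibbs E) := by
  rw [integral_gibbs]
  refine div_pos ?_ (integral_boltzmann_pos _ E)
  exact (f * boltzmann E).continuous.integral_pos_of_hasCompactSupport_nonneg_nonzero
    (.of_compactSpace _) (fun σ => mul_nonneg (hf σ) (Real.exp_pos _).le)
    (mul_ne_zero hτ (Real.exp_ne_zero (E τ)))

lemma integral_boltzmann_mul_gibbs (E F f : C(G, ℝ)) :
    ∫ σ, (boltzmann F * f) σ ∂(gibbs E) =
      (∫ σ, boltzmann F σ ∂(gibbs E)) * ∫ σ, f σ ∂(gibbs (E + F)) := by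
  have hZ := integral_boltzmann_pos (haarProb G) (E + F)
  rw [integral_gibbs, integral_gibbs, integral_gibbs, mul_comm (boltzmann F) f, mul_assoc f,
    mul_comm (boltzmann F), ← boltzmann_add]
  field_simp

lemma integral_boltzmann_neg_gibbs (E F : C(G, ℝ)) :
    ∫ σ, boltzmann (-F) σ ∂(gibbs (E + F)) = (∫ σ, boltzmann F σ ∂(gibbs E))⁻¹ := by
  have hmul : boltzmann F * boltzmann (-F) = 1 := by
    rw [← boltzmann_add, add_neg_cancel]
    ext
    simp [boltzmann]
  have h := integral_boltzmann_mul_gibbs E F (boltzmann (-F))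
  simp only [hmul, ContinuousMap.one_apply, integral_const, probReal_univ, one_smul] at h
  exact eq_inv_of_mul_eq_one_right h.symm

lemma integral_mul_integral_gibbs_le (hE : E ∈ posCone G) (hf : f ∈ posCone G) (hg : g ∈ posCone G)
    (hw : w ∈ ferromagneticWeights G) :
    (∫ σ, (f * w) σ ∂(gibbs E)) * ∫ σ, (g * w) σ ∂(gibbs E) ≤
      (∫ σ, (f * g * w) σ ∂(gibbs E)) * ∫ σ, w σ ∂(gibbs E) := by
  have hZ := integral_boltzmann_pos (haarProb G) E
  have hw' : w * boltzmann E ∈ ferromagneticWeights G :=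
    mul_mem hw (boltzmann_mem_ferromagneticWeights hE)
  simp only [integral_gibbs, div_mul_div_comm, mul_assoc _ w]
  exact div_le_div_of_nonneg_right
    (integral_mul_integral_le_of_ferromagnetic (haarProb G : Measure G) hf hg hw')
    (mul_pos hZ hZ).le

lemma integral_gibbs_le_integral_gibbs_add (hE : E ∈ posCone G) (hF : F ∈ posCone G)
    (hf : f ∈ posCone G) : ∫ σ, f σ ∂(gibbs E) ≤ ∫ σ, f σ ∂(gibbs (E + F)) := by
  have h := integral_mul_integral_gibbs_le hE (boltzmann_mem_posCone hF) hf
    (one_mem (ferromagneticWeights G))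
  simp only [mul_one, integral_boltzmann_mul_gibbs, ContinuousMap.one_apply, integral_const,
    probReal_univ, smul_eq_mul] at h
  exact le_of_mul_le_mul_left h (integral_boltzmann_pos _ F)

lemma integral_boltzmann_neg_gibbs_le (hE : E ∈ posCone G) (hF : F ∈ posCone G)
    {E' : C(G, ℝ)} (hE' : E' ∈ posCone G) :
    ∫ σ, boltzmann (-F) σ ∂(gibbs (E + E' + F)) ≤ ∫ σ, boltzmann (-F) σ ∂(gibbs (E + F)) := by
  rw [integral_boltzmann_neg_gibbs, integral_boltzmann_neg_gibbs]
  exact inv_anti₀ (integral_boltzmann_pos _ F)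
    (integral_gibbs_le_integral_gibbs_add hE hE' (boltzmann_mem_posCone hF))

/-- Conditioning on `χ = 1`, when that event replaces the energy `E'` by `E` up to a constant and
neither `E` nor `f` depends on the spin which `χ` reads. -/
lemma integral_charIndicator_mul_gibbs {E' : C(G, ℝ)} {χ : G →ₜ* ℤˣ} {c : ℝ} {t : G} (ht : χ t = -1)
    (hEE' : ∀ σ, χ σ = 1 → E' σ = E σ + c) (hE : mulTranslate t E = E)
    (hf : mulTranslate t f = f) :
    ∫ σ, (charIndicator χ * f) σ ∂(gibbs E') =
      (∫ σ, charIndicator χ σ ∂(gibbs E')) * ∫ σ, f σ ∂(gibbs E) := by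
  have hweight : charIndicator χ * boltzmann E' = Real.exp c • (charIndicator χ * boltzmann E) := by
    ext σ
    by_cases hσ : χ σ = 1
    · simp [charIndicator_apply, boltzmann, hσ, hEE' σ hσ, Real.exp_add, mul_comm]
    · simp [charIndicator_apply, hσ]
  have hint (g : C(G, ℝ)) (hg : mulTranslate t g = g) :
      ∫ σ, (charIndicator χ * g * boltzmann E') σ ∂(haarProb G) =
        Real.exp c * (2⁻¹ * ∫ σ, (g * boltzmann E) σ ∂(haarProb G)) := by
    have hgE : mulTranslate t (g * boltzmann E) = g * boltzmann E := by
      rw [mulTranslate_mul, hg, show mulTranslate t (boltzmann E) = boltzmann (mulTranslate t E)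
        from rfl, hE]
    rw [← integral_charIndicator_mul (haarProb G : Measure G) ht hgE, mul_right_comm, hweight,
      smul_mul_assoc, mul_right_comm, mul_assoc]
    simp [integral_const_mul]
  have hone := hint 1 rfl
  have hZ := integral_boltzmann_pos (haarProb G) E
  rw [mul_one, one_mul] at hone
  rw [integral_gibbs, integral_gibbs, integral_gibbs, hint f hf, hone]
  field_simp

lemma measurePreserving_gibbs {T : C(G, G)}
    (hT : MeasurePreserving T (haarProb G : Measure G) (haarProb G)) (E : C(G, ℝ)) :
    MeasurePreserving T (gibbs (E.comp T) : Measure G) (gibbs E) := by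
  refine ⟨hT.measurable, Measure.ext fun s hs => ?_⟩
  have hZ : ∫ σ, Real.exp ((E.comp T) σ) ∂(haarProb G) = ∫ σ, Real.exp (E σ) ∂(haarProb G) := by
    conv_rhs => rw [← hT.map_eq, integral_map hT.aemeasurable (by fun_prop)]
    rfl
  rw [Measure.map_apply hT.measurable hs]
  simp only [gibbs, ProbabilityMeasure.coe_mk]
  rw [tilted_apply' _ _ hs, tilted_apply' _ _ (hT.measurable hs), hZ,
    ← hT.setLIntegral_comp_preimage hs (by fun_prop)]
  rfl

end GibbsMeasure

end Griffiths

section LocalFunctions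

variable {d : ℕ}

/-- The character `σ ↦ σ_x` of the group of spin configurations. -/
def siteChar (x : Site d) : Config d →ₜ* ℤˣ := ⟨Pi.evalMonoidHom _ x, continuous_apply x⟩

lemma siteChar_apply (x : Site d) (σ : Config d) : siteChar x σ = σ x := rfl

/-- The spin at `x` as a continuous function. -/
def siteSpin (x : Site d) : C(Config d, ℝ) := spinChar (siteChar x)

lemma siteSpin_apply (x : Site d) (σ : Config d) : siteSpin x σ = spin (σ x) := rfl

lemma siteSpin_mem_posCone (x : Site d) : siteSpin x ∈ posCone (Config d) :=
  spinChar_mem_posCone _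

lemma siteSpin_mul_self (x : Site d) : siteSpin x * siteSpin x = 1 :=
  ContinuousMap.ext fun _ => spin_mul_self _

lemma dependsOn_comp_update {ι α β : Type*} [DecidableEq ι] {f : (ι → α) → β} {a : ι} {s : Set ι}
    (hf : DependsOn f (insert a s)) (b : α) :
    DependsOn (fun σ => f (Function.update σ a b)) s := fun σ τ h => by
  refine hf fun x hx => ?_
  by_cases hxa : x = a
  · simp [hxa]
  · simp [hxa, h x (hx.resolve_left hxa)]

lemma dependsOn_mulTranslate {f : C(Config d, ℝ)} {A : Set (Site d)} (hf : DependsOn f A)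
    {t : Config d} (ht : ∀ x ∈ A, t x = 1) : mulTranslate t f = f :=
  ContinuousMap.ext fun σ => hf fun x hx => by simp [ht x hx]

lemma IsLocal.continuous {f : Config d → ℝ} (hf : IsLocal f) : Continuous f := by
  obtain ⟨A, hA⟩ := hf
  have hfactor : f = (fun σ : A → ℤˣ => f (_root_.extend A σ)) ∘ fun σ (x : A) => σ x :=
    funext fun σ => hA fun x hx => by simp [_root_.extend, Finset.mem_coe.1 hx]
  rw [hfactor]
  exact continuous_of_discreteTopology.comp (by fun_prop)

lemma mem_adjoin_siteSpin_of_dependsOn {A : Finset (Site d)} {f : C(Config d, ℝ)}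
    (hf : DependsOn f (A : Set (Site d))) :
    f ∈ Algebra.adjoin ℝ (Set.range (siteSpin (d := d))) := by
  classical
  induction A using Finset.induction_on generalizing f with
  | empty =>
    have hconst : f = algebraMap ℝ _ (f 1) :=
      ContinuousMap.ext fun σ => hf fun x hx => by simp at hx
    rw [hconst]
    exact Subalgebra.algebraMap_mem _ _
  | insert a A _ ih =>
    rw [Finset.coe_insert] at hf
    let restrictTo (b : ℤˣ) : C(Config d, ℝ) := ⟨fun σ => f (Function.update σ a b), by fun_prop⟩
    have hsplit : f = (2⁻¹ : ℝ) • ((1 + siteSpin a) * restrictTo 1) +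
        (2⁻¹ : ℝ) • ((1 - siteSpin a) * restrictTo (-1)) := by
      ext σ
      have hσ : Function.update σ a (σ a) = σ := Function.update_eq_self a σ
      rcases Int.units_eq_one_or (σ a) with h | h <;> rw [h] at hσ <;>
        simp [restrictTo, siteSpin_apply, h, hσ, spin_one, spin_neg] <;> ring
    have hspin : siteSpin a ∈ Algebra.adjoin ℝ (Set.range (siteSpin (d := d))) :=
      Algebra.subset_adjoin ⟨a, rfl⟩
    have hrestrict (b : ℤˣ) : restrictTo b ∈ Algebra.adjoin ℝ (Set.range (siteSpin (d := d))) :=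
      ih (dependsOn_comp_update hf b)
    rw [hsplit]
    exact add_mem (Subalgebra.smul_mem _ (mul_mem (add_mem (one_mem _) hspin) (hrestrict 1)) _)
      (Subalgebra.smul_mem _ (mul_mem (sub_mem (one_mem _) hspin) (hrestrict (-1))) _)

lemma mem_adjoin_siteSpin_mul_of_isEven {f : C(Config d, ℝ)} (hf : IsLocal f) (heven : IsEven f) :
    f ∈ Algebra.adjoin ℝ (Set.range fun x : Site d => siteSpin 0 * siteSpin x) := by
  obtain ⟨A, hA⟩ := hf
  let rotate : C(Config d, Config d) := ⟨fun σ y => σ 0 * σ y, by fun_prop⟩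
  have hf_rotate : f = ContinuousMap.compRightAlgHom ℝ ℝ rotate f := by
    ext σ
    rcases Int.units_eq_one_or (σ 0) with h | h
    · exact congrArg f (funext fun y => by simp [rotate, h])
    · exact (heven σ).symm.trans (congrArg f (funext fun y => by simp [rotate, h]))
  have hrange : (Set.range fun x : Site d => siteSpin 0 * siteSpin x) =
      ContinuousMap.compRightAlgHom ℝ ℝ rotate '' Set.range siteSpin := by
    rw [← Set.range_comp]
    exact congrArg Set.range (funext fun x => ContinuousMap.ext fun σ => (spin_mul _ _).symm)
  rw [hf_rotate, hrange, ← AlgHom.map_adjoin]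
  exact Subalgebra.mem_map.2 ⟨f, mem_adjoin_siteSpin_of_dependsOn hA, rfl⟩

lemma mul_mem_span_of_forall_mul_mem {R A : Type*} [CommSemiring R] [Semiring A] [Algebra R A]
    {s : Set A} {a v : A} (ha : ∀ b ∈ s, a * b ∈ Submodule.span R s) (hv : v ∈ Submodule.span R s) :
    a * v ∈ Submodule.span R s :=
  Submodule.span_le (p := (Submodule.span R s).comap (LinearMap.mulLeft R a)).2 ha hv

lemma adjoin_le_of_mul_mem {R A : Type*} [CommSemiring R] [Semiring A] [Algebra R A] {s : Set A}
    {V : Submodule R A} (one_mem : 1 ∈ V) (mul_mem : ∀ a ∈ s, ∀ v ∈ V, a * v ∈ V) :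
    (Algebra.adjoin R s).toSubmodule ≤ V := by
  rw [Algebra.adjoin_eq_span, Submodule.span_le]
  intro a ha
  induction ha using Submonoid.closure_induction_left with
  | one => exact one_mem
  | mul_left a ha b _ hb => exact mul_mem a ha b hb

end LocalFunctions

section PlusIndicator

variable {d : ℕ}

/-- The indicator function of the event that all spins in `A` are `1`. -/
noncomputable def plusIndicator (A : Finset (Site d)) : C(Config d, ℝ) :=
  ∏ x ∈ A, charIndicator (siteChar x)

lemma plusIndicator_apply (A : Finset (Site d)) (σ : Config d) [Decidable (∀ x ∈ A, σ x = 1)] :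
    plusIndicator A σ = if ∀ x ∈ A, σ x = 1 then 1 else 0 := by
  simp only [plusIndicator, ContinuousMap.prod_apply, charIndicator_apply, siteChar_apply]
  exact Finset.prod_ite_zero.trans (by simp only [Finset.prod_const_one])

lemma plusIndicator_nonneg (A : Finset (Site d)) : 0 ≤ plusIndicator A := by
  classical
  refine ContinuousMap.le_def.2 fun σ => ?_
  rw [plusIndicator_apply]
  split_ifs
  exacts [zero_le_one, le_rfl]

lemma plusIndicator_mem_posCone (A : Finset (Site d)) : plusIndicator A ∈ posCone (Config d) :=
  prod_mem fun _ _ => charIndicator_mem_posCone _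

lemma plusIndicator_mem_ferromagneticWeights (A : Finset (Site d)) :
    plusIndicator A ∈ ferromagneticWeights (Config d) :=
  prod_mem fun _ _ => charIndicator_mem_ferromagneticWeights _

lemma dependsOn_plusIndicator (A : Finset (Site d)) :
    DependsOn (plusIndicator A) (A : Set (Site d)) := fun σ τ h => by
  simp only [plusIndicator, ContinuousMap.prod_apply]
  exact Finset.prod_congr rfl fun x hx => by
    rw [charIndicator_apply, charIndicator_apply, siteChar_apply, siteChar_apply, h x hx]

lemma plusIndicator_mul_of_subset {A B : Finset (Site d)} (h : A ⊆ B) :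
    plusIndicator A * plusIndicator B = plusIndicator B := by
  classical
  ext σ
  by_cases hB : ∀ x ∈ B, σ x = 1
  · simp [plusIndicator_apply, eq_true hB, eq_true fun x hx => hB x (h hx)]
  · simp [plusIndicator_apply, eq_false hB]

lemma plusIndicator_insert [DecidableEq (Site d)] (a : Site d) (A : Finset (Site d)) :
    plusIndicator (insert a A) = charIndicator (siteChar a) * plusIndicator A := by
  by_cases ha : a ∈ A
  · have h := plusIndicator_mul_of_subset (Finset.singleton_subset_iff.2 ha)
    rw [Finset.insert_eq_of_mem ha]
    conv_lhs => rw [← h, plusIndicator, Finset.prod_singleton]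
  · exact Finset.prod_insert ha

lemma siteSpin_mul_plusIndicator [DecidableEq (Site d)] (a : Site d) (A : Finset (Site d)) :
    siteSpin a * plusIndicator A = (2 : ℝ) • plusIndicator (insert a A) - plusIndicator A := by
  rw [plusIndicator_insert, charIndicator, smul_mul_assoc, smul_inv_smul₀ two_ne_zero, add_mul,
    one_mul, add_sub_cancel_left, siteSpin]

lemma mem_span_plusIndicator {f : C(Config d, ℝ)} (hf : IsLocal f) :
    f ∈ Submodule.span ℝ (Set.range (plusIndicator (d := d))) := by
  classical
  obtain ⟨A, hA⟩ := hf
  refine adjoin_le_of_mul_mem (V := Submodule.span ℝ (Set.range plusIndicator))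
    (Submodule.subset_span ⟨∅, Finset.prod_empty⟩) ?_
    (mem_adjoin_siteSpin_of_dependsOn hA)
  rintro _ ⟨a, rfl⟩ v hv
  refine mul_mem_span_of_forall_mul_mem ?_ hv
  rintro _ ⟨B, rfl⟩
  rw [siteSpin_mul_plusIndicator]
  exact sub_mem (Submodule.smul_mem _ _ (Submodule.subset_span ⟨_, rfl⟩))
    (Submodule.subset_span ⟨B, rfl⟩)

end PlusIndicator

section BondRemoval

variable {d : ℕ} (K : Site d × Site d → ℝ)

/-- The energy of the bonds in `S` with strengths `K`; bonds are ordered pairs of sites. -/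
noncomputable def bondEnergy (S : Finset (Site d × Site d)) : C(Config d, ℝ) :=
  ∑ p ∈ S, K p • (siteSpin p.1 * siteSpin p.2)

lemma bondEnergy_apply (S : Finset (Site d × Site d)) (σ : Config d) :
    bondEnergy K S σ = ∑ p ∈ S, K p * (spin (σ p.1) * spin (σ p.2)) := by
  simp [bondEnergy, siteSpin_apply]

/-- The factor by which the Boltzmann weight changes when the bonds in `S` are removed. -/
noncomputable def bondRemoval (S : Finset (Site d × Site d)) : C(Config d, ℝ) :=
  boltzmann (-bondEnergy K S)

variable {K}

lemma bondEnergy_mem_posCone (hK : 0 ≤ K) (S : Finset (Site d × Site d)) :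
    bondEnergy K S ∈ posCone (Config d) :=
  sum_mem fun p _ => smul_mem_posCone (hK p)
    (mul_mem (siteSpin_mem_posCone p.1) (siteSpin_mem_posCone p.2))

lemma bondEnergy_sdiff_add [DecidableEq (Site d)] {S T : Finset (Site d × Site d)} (h : S ⊆ T) :
    bondEnergy K (T \ S) + bondEnergy K S = bondEnergy K T :=
  Finset.sum_sdiff h

lemma bondRemoval_insert [DecidableEq (Site d)] {p : Site d × Site d}
    {S : Finset (Site d × Site d)} (hp : p ∉ S) :
    bondRemoval K (insert p S) = (Real.cosh (K p) • (1 : C(Config d, ℝ)) -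
      Real.sinh (K p) • (siteSpin p.1 * siteSpin p.2)) * bondRemoval K S := by
  ext σ
  have hexp := exp_mul_spin (-K p) (σ p.1 * σ p.2)
  rw [Real.cosh_neg, Real.sinh_neg, spin_mul] at hexp
  simp only [bondRemoval, boltzmann, ContinuousMap.coe_mk, ContinuousMap.neg_apply,
    bondEnergy_apply, Finset.sum_insert hp, neg_add, Real.exp_add, ← neg_mul, hexp,
    ContinuousMap.mul_apply, ContinuousMap.sub_apply, ContinuousMap.smul_apply, siteSpin_apply,
    ContinuousMap.one_apply, smul_eq_mul]
  ring

lemma bond_mul_bondRemoval_mem_span {p : Site d × Site d} (hp : K p ≠ 0)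
    (S : Finset (Site d × Site d)) :
    siteSpin p.1 * siteSpin p.2 * bondRemoval K S ∈
      Submodule.span ℝ (Set.range (bondRemoval K)) := by
  classical
  set V := Submodule.span ℝ (Set.range (bondRemoval K))
  have hmem (T) : bondRemoval K T ∈ V := Submodule.subset_span ⟨T, rfl⟩
  have hnotMem {T} (hpT : p ∉ T) : siteSpin p.1 * siteSpin p.2 * bondRemoval K T ∈ V := by
    have hsinh : Real.sinh (K p) ≠ 0 := Real.sinh_ne_zero.2 hp
    have heq : siteSpin p.1 * siteSpin p.2 * bondRemoval K T = (Real.sinh (K p))⁻¹ •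
        (Real.cosh (K p) • bondRemoval K T - bondRemoval K (insert p T)) := by
      rw [bondRemoval_insert hpT, sub_mul, smul_one_mul, sub_sub_cancel, smul_mul_assoc,
        inv_smul_smul₀ hsinh]
    rw [heq]
    exact V.smul_mem _ (sub_mem (V.smul_mem _ (hmem _)) (hmem _))
  by_cases hpS : p ∈ S
  · have hpT := Finset.notMem_erase p S
    have hsq : siteSpin p.1 * siteSpin p.2 * (siteSpin p.1 * siteSpin p.2) = 1 := by
      rw [mul_mul_mul_comm, siteSpin_mul_self, siteSpin_mul_self, one_mul]
    have heq : siteSpin p.1 * siteSpin p.2 * bondRemoval K S =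
        Real.cosh (K p) • (siteSpin p.1 * siteSpin p.2 * bondRemoval K (S.erase p)) -
          Real.sinh (K p) • bondRemoval K (S.erase p) := by
      conv_lhs => rw [← Finset.insert_erase hpS, bondRemoval_insert hpT, ← mul_assoc, mul_sub,
        mul_smul_comm, mul_smul_comm, hsq, mul_one, sub_mul, smul_mul_assoc, smul_one_mul]
    rw [heq]
    exact sub_mem (V.smul_mem _ (hnotMem hpT)) (V.smul_mem _ (hmem _))
  · exact hnotMem hpS

end BondRemoval

section FiniteVolume

variable {d : ℕ}

lemma extend_apply_coe {Λ : Finset (Site d)} (τ : Λ → ℤˣ) (x : Λ) :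
    _root_.extend Λ τ x = τ x := dif_pos x.2

lemma sum_extend_eq_card_mul_integral {Λ : Finset (Site d)} {f : C(Config d, ℝ)}
    (hf : DependsOn f (Λ : Set (Site d))) :
    ∑ τ : Λ → ℤˣ, f (_root_.extend Λ τ) =
      Fintype.card (Λ → ℤˣ) * ∫ σ, f σ ∂(haarProb (Config d)) := by
  have hshift (σ : Config d) :
      ∑ τ, f (_root_.extend Λ τ * σ) = ∑ τ, f (_root_.extend Λ τ) := by
    rw [← Equiv.sum_comp (Equiv.mulRight fun x : Λ => σ x) fun τ => f (_root_.extend Λ τ)]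
    refine Finset.sum_congr rfl fun τ _ => hf fun x hx => ?_
    simp [_root_.extend, Finset.mem_coe.1 hx]
  calc ∑ τ, f (_root_.extend Λ τ)
      = ∫ σ, ∑ τ, f (_root_.extend Λ τ * σ) ∂(haarProb (Config d)) := by simp [hshift]
    _ = ∑ τ, ∫ σ, f (_root_.extend Λ τ * σ) ∂(haarProb (Config d)) :=
        integral_finsetSum _ fun τ _ =>
          integrable_continuousMap _ (f.comp (ContinuousMap.mulLeft (_root_.extend Λ τ)))
    _ = Fintype.card (Λ → ℤˣ) * ∫ σ, f σ ∂(haarProb (Config d)) := by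
        simp only [integral_mul_left_eq_self (fun σ => f σ), Finset.sum_const, nsmul_eq_mul,
          Finset.card_univ]

variable {J : Site d → Site d → ℝ} {β : ℝ}

lemma finiteGibbs_eq_integral_gibbs {h : ℝ} {τ : Site d → SignType} {Λ : Finset (Site d)}
    {E f : C(Config d, ℝ)} (hE : DependsOn E (Λ : Set (Site d)))
    (hEτ : ∀ σ, E (_root_.extend Λ σ) = -β * hamiltonian J h τ Λ σ)
    (hf : DependsOn f (Λ : Set (Site d))) :
    finiteGibbs J β h τ Λ f = ∫ σ, f σ ∂(gibbs E) := by
  have hZ : partitionFunction J β h τ Λ =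
      Fintype.card (Λ → ℤˣ) * ∫ σ, boltzmann E σ ∂(haarProb (Config d)) := by
    rw [← sum_extend_eq_card_mul_integral fun σ τ h => congrArg Real.exp (hE h)]
    exact Finset.sum_congr rfl fun σ _ => congrArg Real.exp (hEτ σ).symm
  have hsum : ∑ σ : Λ → ℤˣ, f (_root_.extend Λ σ) * Real.exp (-β * hamiltonian J h τ Λ σ) =
      Fintype.card (Λ → ℤˣ) * ∫ σ, (f * boltzmann E) σ ∂(haarProb (Config d)) := by
    rw [← sum_extend_eq_card_mul_integral fun σ τ h =>
      congrArg₂ (· * ·) (hf h) (congrArg Real.exp (hE h))]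
    exact Finset.sum_congr rfl fun σ _ => by simp only [← hEτ]; rfl
  have hcard : (Fintype.card (Λ → ℤˣ) : ℝ) ≠ 0 := Nat.cast_ne_zero.2 Fintype.card_ne_zero
  simp only [finiteGibbs, mul_div_assoc', ← Finset.sum_div]
  rw [integral_gibbs, hZ, hsum, mul_div_mul_left _ _ hcard]

variable (J β)

/-- The strength of the ordered bond `p` at inverse temperature `β`. Every unordered bond appears
as two ordered ones, hence the factor `1/2`. -/
noncomputable def coupling (p : Site d × Site d) : ℝ :=
  if p.1 = p.2 then 0 else β / 2 * J p.1 p.2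

/-- The energy `-β H` in the volume `Λ` with free boundary condition. -/
noncomputable def freeEnergy (Λ : Finset (Site d)) : C(Config d, ℝ) :=
  bondEnergy (coupling J β) (Λ ×ˢ Λ)

/-- The total coupling of the site `x` to the complement of `Λ`. -/
noncomputable def plusField (Λ : Finset (Site d)) (x : Site d) : ℝ :=
  ∑' y : {y : Site d // y ∉ Λ}, J x y

/-- The energy `-β H` in the volume `Λ` with plus boundary condition. -/
noncomputable def plusEnergy (Λ : Finset (Site d)) : C(Config d, ℝ) :=
  freeEnergy J β Λ + ∑ x ∈ Λ, (β * plusField J Λ x) • siteSpin x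

lemma plusEnergy_apply (Λ : Finset (Site d)) (σ : Config d) :
    plusEnergy J β Λ σ = freeEnergy J β Λ σ + ∑ x ∈ Λ, β * plusField J Λ x * spin (σ x) := by
  simp [plusEnergy, siteSpin_apply]

lemma dependsOn_freeEnergy (Λ : Finset (Site d)) :
    DependsOn (freeEnergy J β Λ) (Λ : Set (Site d)) := fun σ τ h => by
  simp only [freeEnergy, bondEnergy_apply]
  refine Finset.sum_congr rfl fun p hp => ?_
  rw [h p.1 (Finset.mem_product.1 hp).1, h p.2 (Finset.mem_product.1 hp).2]

lemma dependsOn_plusEnergy (Λ : Finset (Site d)) :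
    DependsOn (plusEnergy J β Λ) (Λ : Set (Site d)) := fun σ τ h => by
  rw [plusEnergy_apply, plusEnergy_apply, dependsOn_freeEnergy J β Λ h]
  exact congrArg _ (Finset.sum_congr rfl fun x hx => by rw [h x hx])

lemma freeEnergy_extend (Λ : Finset (Site d)) (σ : Λ → ℤˣ) :
    freeEnergy J β Λ (_root_.extend Λ σ) = -β * hamiltonian J 0 (fun _ => 0) Λ σ := by
  have hpairs : freeEnergy J β Λ (_root_.extend Λ σ) = β / 2 *
      ∑ x : Λ, ∑ y : Λ, if x ≠ y then J x y * spin (σ x) * spin (σ y) else 0 := by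
    rw [freeEnergy, bondEnergy_apply, Finset.sum_product, ← Finset.sum_coe_sort Λ]
    simp only [Finset.mul_sum]
    refine Finset.sum_congr rfl fun x _ => ?_
    rw [← Finset.sum_coe_sort Λ]
    refine Finset.sum_congr rfl fun y _ => ?_
    by_cases hxy : x = y
    · simp [hxy, coupling]
    · simp only [coupling, Subtype.coe_inj, hxy, extend_apply_coe, if_false, ne_eq,
        not_false_eq_true, if_true]
      ring
  rw [hpairs, hamiltonian]
  simp only [SignType.coe_zero, mul_zero, tsum_zero, Finset.sum_const_zero, zero_mul]
  ring

lemma plusEnergy_extend (Λ : Finset (Site d)) (σ : Λ → ℤˣ) :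
    plusEnergy J β Λ (_root_.extend Λ σ) = -β * hamiltonian J 0 (fun _ => 1) Λ σ := by
  have hfield : ∑ x ∈ Λ, β * plusField J Λ x * spin (_root_.extend Λ σ x) =
      β * ∑ x : Λ, ∑' y : {y : Site d // y ∉ Λ}, J x y * spin (σ x) := by
    rw [← Finset.sum_coe_sort Λ, Finset.mul_sum]
    exact Finset.sum_congr rfl fun x _ => by
      rw [extend_apply_coe, plusField, mul_assoc, tsum_mul_right]
  rw [plusEnergy_apply, freeEnergy_extend, hfield, hamiltonian, hamiltonian]
  simp only [SignType.coe_zero, SignType.coe_one, mul_zero, mul_one, tsum_zero,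
    Finset.sum_const_zero]
  ring

variable {J β}

section Positivity

lemma coupling_nonneg (hJ : IsFerromagnetic J) (hβ : 0 ≤ β) : 0 ≤ coupling J β := fun p => by
  rw [coupling]
  split_ifs
  · exact le_rfl
  · exact mul_nonneg (by positivity) (hJ.nonneg _ _)

lemma plusEnergy_mem_posCone (hJ : IsFerromagnetic J) (hβ : 0 ≤ β) (Λ : Finset (Site d)) :
    plusEnergy J β Λ ∈ posCone (Config d) :=
  add_mem (bondEnergy_mem_posCone (coupling_nonneg hJ hβ) _) <| sum_mem fun x _ =>
    smul_mem_posCone (mul_nonneg hβ (tsum_nonneg fun _ => hJ.nonneg _ _)) (siteSpin_mem_posCone x)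

end Positivity

section Translation

lemma IsFerromagnetic.map_add (hJ : IsFerromagnetic J) (x y a : Site d) :
    J (x + a) (y + a) = J x y := by
  rw [hJ.translation_invariant, hJ.translation_invariant x, add_sub_add_right_eq_sub]

/-- The translation of configurations by `x` as a continuous map. -/
def shiftMap (x : Site d) : C(Config d, Config d) := ⟨shift x, by unfold shift; fun_prop⟩

/-- The global spin flip as a continuous map. -/
def flipMap : C(Config d, Config d) := ⟨fun σ => -σ, by fun_prop⟩

/-- The translate `A + x`. -/
def translateBy {M : Type*} [AddRightCancelSemigroup M] (x : M) (A : Finset M) : Finset M :=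
  A.map (addRightEmbedding x)

lemma plusIndicator_comp_shiftMap (x : Site d) (A : Finset (Site d)) :
    (plusIndicator A).comp (shiftMap x) = plusIndicator (translateBy x A) := by
  ext σ
  simp only [plusIndicator, translateBy, Finset.prod_map, ContinuousMap.comp_apply,
    ContinuousMap.prod_apply]
  rfl

lemma bondEnergy_comp_shiftMap (hJ : IsFerromagnetic J) (x : Site d)
    (S : Finset (Site d × Site d)) :
    (bondEnergy (coupling J β) S).comp (shiftMap x) =
      bondEnergy (coupling J β) (translateBy (x, x) S) := by
  ext σ
  simp [bondEnergy_apply, translateBy, shiftMap, shift, coupling, hJ.map_add]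

lemma bondRemoval_comp_shiftMap (hJ : IsFerromagnetic J) (x : Site d)
    (S : Finset (Site d × Site d)) :
    (bondRemoval (coupling J β) S).comp (shiftMap x) =
      bondRemoval (coupling J β) (translateBy (x, x) S) := by
  rw [bondRemoval, bondRemoval, ← bondEnergy_comp_shiftMap hJ]
  rfl

lemma translateBy_product (x : Site d) (Λ : Finset (Site d)) :
    translateBy (x, x) (Λ ×ˢ Λ) = translateBy x Λ ×ˢ translateBy x Λ :=
  Finset.prodMap_map_product (addRightEmbedding x) (addRightEmbedding x) Λ Λ

lemma freeEnergy_comp_shiftMap (hJ : IsFerromagnetic J) (x : Site d) (Λ : Finset (Site d)) :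
    (freeEnergy J β Λ).comp (shiftMap x) = freeEnergy J β (translateBy x Λ) := by
  rw [freeEnergy, bondEnergy_comp_shiftMap hJ, translateBy_product, freeEnergy]

lemma plusField_translateBy (hJ : IsFerromagnetic J) (a x : Site d) (Λ : Finset (Site d)) :
    plusField J (translateBy a Λ) (x + a) = plusField J Λ x := by
  have hmem (y : Site d) : y ∉ Λ ↔ Equiv.addRight a y ∉ translateBy a Λ := by simp [translateBy]
  exact (Equiv.tsum_eq ((Equiv.addRight a).subtypeEquiv hmem) _).symm.trans <|
    tsum_congr fun y => hJ.map_add x y a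

lemma plusEnergy_comp_shiftMap (hJ : IsFerromagnetic J) (x : Site d) (Λ : Finset (Site d)) :
    (plusEnergy J β Λ).comp (shiftMap x) = plusEnergy J β (translateBy x Λ) := by
  ext σ
  simp only [plusEnergy_apply, ContinuousMap.comp_apply, ← freeEnergy_comp_shiftMap hJ]
  rw [translateBy, Finset.sum_map]
  exact congrArg _ (Finset.sum_congr rfl fun y _ => by
    rw [← plusField_translateBy hJ x y]; rfl)

lemma measurePreserving_shift_haarProb (x : Site d) :
    MeasurePreserving (shift x) (haarProb (Config d) : Measure (Config d))
      (haarProb (Config d)) := by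
  let shiftHom : Config d →* Config d := ⟨⟨shift x, rfl⟩, fun _ _ => rfl⟩
  exact shiftHom.measurePreserving (shiftMap x).continuous
    (fun σ => ⟨shift (-x) σ, funext fun y => congrArg σ (add_neg_cancel_right y x)⟩) (by simp)

lemma measurePreserving_neg_haarProb :
    MeasurePreserving (fun σ : Config d => -σ) (haarProb (Config d) : Measure (Config d))
      (haarProb (Config d)) := by
  simpa using measurePreserving_mul_left (haarProb (Config d) : Measure (Config d)) (-1)

end Translation

end FiniteVolume

section PlusState

variable {d : ℕ} {J : Site d → Site d → ℝ} {β : ℝ} {A Λ Λ' : Finset (Site d)} {f : C(Config d, ℝ)}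

lemma IsFerromagnetic.summable (hJ : IsFerromagnetic J) (x : Site d) : Summable (J x) := by
  have h := (Equiv.subRight x).summable_iff.2 hJ.locally_finite
  exact h.congr fun y => (hJ.translation_invariant x y).symm

lemma plusField_insert [DecidableEq (Site d)] (hJ : IsFerromagnetic J) {a : Site d} (ha : a ∉ Λ)
    (x : Site d) : plusField J Λ x = plusField J (insert a Λ) x + J x a := by
  have h := (hJ.summable x).sum_add_tsum_subtype_compl Λ
  rw [← (hJ.summable x).sum_add_tsum_subtype_compl (insert a Λ), Finset.sum_insert ha] at h
  change ∑' y : {y : Site d // y ∉ Λ}, J x y = ∑' y : {y : Site d // y ∉ insert a Λ}, J x y + J x a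
  linarith

lemma coupling_symm (hJ : IsFerromagnetic J) (x y : Site d) :
    coupling J β (x, y) = coupling J β (y, x) := by
  simp only [coupling, eq_comm (a := x), hJ.symm x y]

lemma freeEnergy_insert_apply [DecidableEq (Site d)] (hJ : IsFerromagnetic J) {a : Site d}
    (ha : a ∉ Λ) (σ : Config d) :
    freeEnergy J β (insert a Λ) σ =
      freeEnergy J β Λ σ + ∑ x ∈ Λ, β * J x a * (spin (σ x) * spin (σ a)) := by
  have hterm (x : Site d) (hx : x ∈ Λ) : 2 * coupling J β (x, a) = β * J x a := by
    rw [coupling, if_neg (ne_of_mem_of_not_mem hx ha)]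
    ring
  have hsum : ∑ x ∈ Λ, β * J x a * (spin (σ x) * spin (σ a)) =
      2 * ∑ x ∈ Λ, coupling J β (x, a) * (spin (σ x) * spin (σ a)) := by
    rw [Finset.mul_sum]
    exact Finset.sum_congr rfl fun x hx => by rw [← hterm x hx, mul_assoc]
  have hdiag : coupling J β (a, a) = 0 := if_pos rfl
  simp only [freeEnergy, bondEnergy_apply, Finset.sum_product, Finset.sum_insert ha,
    Finset.sum_add_distrib, hdiag, hsum, coupling_symm hJ a, mul_comm (spin (σ a))]
  ring

lemma plusEnergy_insert_of_eq_one [DecidableEq (Site d)] (hJ : IsFerromagnetic J) {a : Site d}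
    (ha : a ∉ Λ) {σ : Config d} (hσ : σ a = 1) :
    plusEnergy J β (insert a Λ) σ = plusEnergy J β Λ σ + β * plusField J (insert a Λ) a := by
  simp only [plusEnergy_apply, freeEnergy_insert_apply hJ ha, Finset.sum_insert ha, hσ, spin_one,
    plusField_insert hJ ha, mul_add, add_mul, Finset.sum_add_distrib, mul_one]
  ring

lemma integral_plusIndicator_mul_gibbs_union [DecidableEq (Site d)] (hJ : IsFerromagnetic J)
    (hΛA : Disjoint Λ A) (hf : DependsOn f (Λ : Set (Site d))) :
    ∫ σ, (plusIndicator A * f) σ ∂(gibbs (plusEnergy J β (Λ ∪ A))) =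
      (∫ σ, plusIndicator A σ ∂(gibbs (plusEnergy J β (Λ ∪ A)))) *
        ∫ σ, f σ ∂(gibbs (plusEnergy J β Λ)) := by
  induction A using Finset.induction_on with
  | empty => simp [plusIndicator]
  | insert a A ha ih =>
    obtain ⟨haΛ, hΛA⟩ := Finset.disjoint_insert_right.1 hΛA
    have ha' : a ∉ Λ ∪ A := by simp [haΛ, ha]
    let flip : Config d := Pi.mulSingle a (-1)
    have hflip (x : Site d) (hx : x ∈ (Λ ∪ A : Finset (Site d))) : flip x = 1 :=
      Pi.mulSingle_eq_of_ne (ne_of_mem_of_not_mem hx ha') _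
    have hremove {g : C(Config d, ℝ)}
        (hg : DependsOn g ((Λ ∪ A : Finset (Site d)) : Set (Site d))) :=
      integral_charIndicator_mul_gibbs (χ := siteChar a) (Pi.mulSingle_eq_same a (-1))
        (fun σ hσ => plusEnergy_insert_of_eq_one (β := β) hJ ha' hσ)
        (dependsOn_mulTranslate (dependsOn_plusEnergy J β _) hflip)
        (dependsOn_mulTranslate hg hflip)
    have hA : DependsOn (plusIndicator A) ((Λ ∪ A : Finset (Site d)) : Set (Site d)) :=
      (dependsOn_plusIndicator A).mono (by simp)
    have hAf : DependsOn (plusIndicator A * f) ((Λ ∪ A : Finset (Site d)) : Set (Site d)) :=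
      fun σ τ h => congrArg₂ (· * ·) (hA h) (hf.mono (by simp) h)
    rw [Finset.union_insert, plusIndicator_insert, mul_assoc, hremove hAf, hremove hA, ih hΛA,
      mul_assoc]

lemma integral_plusIndicator_pos (E : C(Config d, ℝ)) (A : Finset (Site d)) :
    0 < ∫ σ, plusIndicator A σ ∂(gibbs E) :=
  integral_gibbs_pos E (plusIndicator_nonneg A) (τ := 1) (by classical simp [plusIndicator_apply])

lemma integral_plusIndicator_mul_gibbs_le (hJ : IsFerromagnetic J) (hβ : 0 ≤ β)
    (hΛ : Λ ⊆ Λ') (hA : A ⊆ Λ') (hΛA : Disjoint Λ A) (hf : f ∈ posCone (Config d))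
    (hfΛ : DependsOn f (Λ : Set (Site d))) :
    ∫ σ, (plusIndicator A * f) σ ∂(gibbs (plusEnergy J β Λ')) ≤
      (∫ σ, plusIndicator A σ ∂(gibbs (plusEnergy J β Λ'))) *
        ∫ σ, f σ ∂(gibbs (plusEnergy J β Λ)) := by
  classical
  have hpos := integral_plusIndicator_pos (plusEnergy J β Λ') (Λ' \ Λ)
  have hsplit := integral_plusIndicator_mul_gibbs_union (β := β) hJ
    (Finset.disjoint_sdiff (s := Λ) (t := Λ')) hfΛ
  rw [Finset.union_sdiff_of_subset hΛ] at hsplit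
  have hsub : A ⊆ Λ' \ Λ := Finset.subset_sdiff.2 ⟨hA, hΛA.symm⟩
  have hmul : plusIndicator (Λ' \ Λ) * plusIndicator A = plusIndicator (Λ' \ Λ) := by
    rw [mul_comm, plusIndicator_mul_of_subset hsub]
  have hgriffiths := integral_mul_integral_gibbs_le (plusEnergy_mem_posCone hJ hβ Λ') hf
    (plusIndicator_mem_posCone (Λ' \ Λ)) (plusIndicator_mem_ferromagneticWeights A)
  rw [mul_assoc f, hmul, mul_comm f, mul_comm f, hsplit] at hgriffiths
  refine le_of_mul_le_mul_right (hgriffiths.trans_eq ?_) hpos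
  ring

lemma integral_gibbs_plusEnergy_anti (hJ : IsFerromagnetic J) (hβ : 0 ≤ β)
    (hΛ : Λ ⊆ Λ') (hf : f ∈ posCone (Config d)) (hfΛ : DependsOn f (Λ : Set (Site d))) :
    ∫ σ, f σ ∂(gibbs (plusEnergy J β Λ')) ≤ ∫ σ, f σ ∂(gibbs (plusEnergy J β Λ)) := by
  simpa [plusIndicator] using integral_plusIndicator_mul_gibbs_le hJ hβ hΛ (Finset.empty_subset _)
    (Finset.disjoint_empty_right _) hf hfΛ

lemma integral_mul_integral_plusIndicator_le {E : C(Config d, ℝ)} (hE : E ∈ posCone (Config d))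
    (A B : Finset (Site d)) :
    (∫ σ, plusIndicator A σ ∂(gibbs E)) * ∫ σ, plusIndicator B σ ∂(gibbs E) ≤
      ∫ σ, (plusIndicator A * plusIndicator B) σ ∂(gibbs E) := by
  simpa using integral_mul_integral_gibbs_le hE (plusIndicator_mem_posCone A)
    (plusIndicator_mem_posCone B) (one_mem (ferromagneticWeights (Config d)))

end PlusState

section FreeState

variable {d : ℕ} {K : Site d × Site d → ℝ} {S T U : Finset (Site d × Site d)}

lemma integral_bondRemoval_anti (hK : 0 ≤ K) (hTS : T ⊆ S) (hSU : S ⊆ U) :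
    ∫ σ, bondRemoval K T σ ∂(gibbs (bondEnergy K U)) ≤
      ∫ σ, bondRemoval K T σ ∂(gibbs (bondEnergy K S)) := by
  classical
  have hS : bondEnergy K S = bondEnergy K (S \ T) + bondEnergy K T :=
    (bondEnergy_sdiff_add hTS).symm
  have hU : bondEnergy K U =
      bondEnergy K (S \ T) + bondEnergy K (U \ S) + bondEnergy K T := by
    rw [← bondEnergy_sdiff_add hSU, hS]
    abel
  rw [hS, hU]
  exact integral_boltzmann_neg_gibbs_le (bondEnergy_mem_posCone hK _) (bondEnergy_mem_posCone hK _)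
    (bondEnergy_mem_posCone hK _)

lemma integral_bondRemoval_mul [DecidableEq (Site d)] (hSU : S ⊆ U) (f : C(Config d, ℝ)) :
    ∫ σ, (bondRemoval K S * f) σ ∂(gibbs (bondEnergy K U)) =
      (∫ σ, bondRemoval K S σ ∂(gibbs (bondEnergy K U))) *
        ∫ σ, f σ ∂(gibbs (bondEnergy K (U \ S))) := by
  rw [bondRemoval, integral_boltzmann_mul_gibbs, ← sub_eq_add_neg, ← bondEnergy_sdiff_add hSU,
    add_sub_cancel_right]

lemma integral_mul_integral_bondRemoval_le (hK : 0 ≤ K) (hST : Disjoint S T) (hSU : S ⊆ U)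
    (hTU : T ⊆ U) :
    (∫ σ, bondRemoval K S σ ∂(gibbs (bondEnergy K U))) *
        ∫ σ, bondRemoval K T σ ∂(gibbs (bondEnergy K U)) ≤
      ∫ σ, (bondRemoval K S * bondRemoval K T) σ ∂(gibbs (bondEnergy K U)) := by
  classical
  rw [integral_bondRemoval_mul hSU]
  exact mul_le_mul_of_nonneg_left
    (integral_bondRemoval_anti hK (Finset.subset_sdiff.2 ⟨hTU, hST.symm⟩) Finset.sdiff_subset)
    (integral_boltzmann_pos _ _).le

lemma integral_bondRemoval_mul_le (hK : 0 ≤ K) {T' : Finset (Site d × Site d)} (hSU : S ⊆ U)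
    (hTT' : T ⊆ T') (hT'U : T' ⊆ U) (hST' : Disjoint S T') :
    ∫ σ, (bondRemoval K S * bondRemoval K T) σ ∂(gibbs (bondEnergy K U)) ≤
      (∫ σ, bondRemoval K S σ ∂(gibbs (bondEnergy K U))) *
        ∫ σ, bondRemoval K T σ ∂(gibbs (bondEnergy K T')) := by
  classical
  rw [integral_bondRemoval_mul hSU]
  exact mul_le_mul_of_nonneg_left
    (integral_bondRemoval_anti hK hTT' (Finset.subset_sdiff.2 ⟨hT'U, hST'.symm⟩))
    (integral_boltzmann_pos _ _).le

lemma integral_gibbs_bondEnergy_mono (hK : 0 ≤ K) {f : C(Config d, ℝ)}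
    (hf : f ∈ posCone (Config d)) (h : S ⊆ T) :
    ∫ σ, f σ ∂(gibbs (bondEnergy K S)) ≤ ∫ σ, f σ ∂(gibbs (bondEnergy K T)) := by
  classical
  rw [← bondEnergy_sdiff_add h, add_comm]
  exact integral_gibbs_le_integral_gibbs_add (bondEnergy_mem_posCone hK _)
    (bondEnergy_mem_posCone hK _) hf

end FreeState

section EvenFunctions

variable {d : ℕ} {J : Site d → Site d → ℝ} {β : ℝ}

lemma mul_mem_span_bondRemoval {K : Site d × Site d → ℝ} {p : Site d × Site d} (hp : K p ≠ 0)
    {f : C(Config d, ℝ)} (hf : f ∈ Submodule.span ℝ (Set.range (bondRemoval K))) :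
    siteSpin p.1 * siteSpin p.2 * f ∈ Submodule.span ℝ (Set.range (bondRemoval K)) := by
  refine mul_mem_span_of_forall_mul_mem ?_ hf
  rintro _ ⟨S, rfl⟩
  exact bond_mul_bondRemoval_mem_span hp S

lemma coupling_ne_zero (hβ : β ≠ 0) {x y : Site d} (hxy : x ≠ y) (hJ : J x y ≠ 0) :
    coupling J β (x, y) ≠ 0 := by
  simp [coupling, hxy, hJ, hβ]

lemma path_mul_mem_span_bondRemoval (hβ : β ≠ 0) (p : ℕ → Site d) (m : ℕ)
    (hp : ∀ i < m, J (p i) (p (i + 1)) ≠ 0) {f : C(Config d, ℝ)}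
    (hf : f ∈ Submodule.span ℝ (Set.range (bondRemoval (coupling J β)))) :
    siteSpin (p 0) * siteSpin (p m) * f ∈
      Submodule.span ℝ (Set.range (bondRemoval (coupling J β))) := by
  induction m with
  | zero => rwa [siteSpin_mul_self, one_mul]
  | succ m ih =>
    have hpath := ih fun i hi => hp i (hi.trans m.lt_succ_self)
    by_cases hstep : p m = p (m + 1)
    · rwa [← hstep]
    · have hmem := mul_mem_span_bondRemoval
        (coupling_ne_zero hβ hstep (hp m m.lt_succ_self)) hpath
      have hcancel : siteSpin (p m) * siteSpin (p (m + 1)) * (siteSpin (p 0) * siteSpin (p m) * f) =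
          siteSpin (p 0) * siteSpin (p (m + 1)) * f := by
        linear_combination (siteSpin (p 0) * siteSpin (p (m + 1)) * f) * siteSpin_mul_self (p m)
      rwa [hcancel] at hmem

lemma mem_span_bondRemoval (hJ : IsFerromagnetic J) (hβ : β ≠ 0) {f : C(Config d, ℝ)}
    (hf : IsLocal f) (heven : IsEven f) :
    f ∈ Submodule.span ℝ (Set.range (bondRemoval (coupling J β))) := by
  refine adjoin_le_of_mul_mem (V := Submodule.span ℝ (Set.range (bondRemoval (coupling J β))))
    (Submodule.subset_span ⟨∅, ?_⟩) ?_ (mem_adjoin_siteSpin_mul_of_isEven hf heven)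
  · ext σ
    simp [bondRemoval, bondEnergy, boltzmann]
  · rintro _ ⟨x, rfl⟩ f hf
    obtain ⟨m, p, hp₀, rfl, hpos⟩ := hJ.aperiodic x
    rw [← hp₀]
    exact path_mul_mem_span_bondRemoval hβ p m
      (fun i hi => Finset.prod_ne_zero_iff.1 hpos.ne' i (Finset.mem_range.2 hi)) hf

end EvenFunctions

section WeakLimits

variable {d : ℕ} {ι : Type*} {l : Filter ι} {ν : ι → ProbabilityMeasure (Config d)}
  {μ μ' : ProbabilityMeasure (Config d)}

lemma isLocal_indicator_cylinder {A : Finset (Site d)} (S : Set (A → ℤˣ)) :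
    IsLocal ((cylinder A S).indicator fun _ => (1 : ℝ)) :=
  ⟨A, fun σ τ h => by
    have hrestrict : A.restrict σ = A.restrict τ := funext fun x => h x x.2
    classical simp only [Set.indicator_apply, mem_cylinder, hrestrict]⟩

lemma eq_of_forall_integral_eq
    (h : ∀ f : C(Config d, ℝ), IsLocal f → ∫ σ, f σ ∂μ = ∫ σ, f σ ∂μ') : μ = μ' := by
  refine ProbabilityMeasure.toMeasure_injective <|
    ext_of_generate_finite (measurableCylinders fun _ : Site d => ℤˣ)
      generateFrom_measurableCylinders.symm isPiSystem_measurableCylinders (fun s hs => ?_)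
      (by simp)
  obtain ⟨A, S, hS, rfl⟩ := (mem_measurableCylinders _).1 hs
  have hlocal := isLocal_indicator_cylinder S
  have hint := h ⟨_, hlocal.continuous⟩ hlocal
  simp only [ContinuousMap.coe_mk] at hint
  rw [integral_indicator_const _ (hS.cylinder A),
    integral_indicator_const _ (hS.cylinder A)] at hint
  simpa [measureReal_def, ENNReal.toReal_eq_toReal_iff'] using hint

lemma continuous_integral_continuousMap (f : C(Config d, ℝ)) :
    Continuous fun μ : ProbabilityMeasure (Config d) => ∫ σ, f σ ∂μ :=
  ProbabilityMeasure.continuous_integral_boundedContinuousFunction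
    (BoundedContinuousFunction.mkOfCompact f)

lemma integral_eq_of_mapClusterPt (hμ : MapClusterPt μ l ν) {f : C(Config d, ℝ)} {a : ℝ}
    (ha : Tendsto (fun i => ∫ σ, f σ ∂(ν i)) l (𝓝 a)) : ∫ σ, f σ ∂μ = a := by
  have hcluster := hμ.continuousAt_comp (continuous_integral_continuousMap f).continuousAt
  exact eq_of_nhds_neBot (hcluster.clusterPt.mono ha)

lemma tendsto_of_forall_tendsto_integral (h : ∀ f : C(Config d, ℝ), IsLocal f →
    Tendsto (fun i => ∫ σ, f σ ∂(ν i)) l (𝓝 (∫ σ, f σ ∂μ))) : Tendsto ν l (𝓝 μ) :=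
  tendsto_nhds_of_unique_mapClusterPt fun _ hμ' =>
    eq_of_forall_integral_eq fun f hf => integral_eq_of_mapClusterPt hμ' (h f hf)

lemma exists_tendsto_of_forall_tendsto_integral_plusIndicator [NeBot l]
    (h : ∀ A : Finset (Site d), ∃ a : ℝ, Tendsto (fun i => ∫ σ, plusIndicator A σ ∂(ν i)) l (𝓝 a)) :
    ∃ μ, Tendsto ν l (𝓝 μ) := by
  have hlocal (f : C(Config d, ℝ)) (hf : IsLocal f) :
      ∃ a, Tendsto (fun i => ∫ σ, f σ ∂(ν i)) l (𝓝 a) := by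
    replace hf := mem_span_plusIndicator hf
    induction hf using Submodule.span_induction with
    | mem f hf => obtain ⟨A, rfl⟩ := hf; exact h A
    | zero => exact ⟨0, by simp⟩
    | add f g _ _ hf hg =>
      obtain ⟨a, ha⟩ := hf
      obtain ⟨b, hb⟩ := hg
      refine ⟨a + b, (ha.add hb).congr fun i => ?_⟩
      exact (integral_add (integrable_continuousMap _ f) (integrable_continuousMap _ g)).symm
    | smul c f _ hf =>
      obtain ⟨a, ha⟩ := hf
      exact ⟨c * a, (ha.const_mul c).congr fun i => (integral_const_mul c _).symm⟩
  obtain ⟨μ, hμ⟩ := exists_clusterPt_of_compactSpace (map ν l)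
  refine ⟨μ, tendsto_of_forall_tendsto_integral fun f hf => ?_⟩
  obtain ⟨a, ha⟩ := hlocal f hf
  rwa [integral_eq_of_mapClusterPt hμ ha]

lemma measurePreserving_of_tendsto_gibbs [NeBot l] {E : ι → C(Config d, ℝ)}
    (hμ : Tendsto (fun i => gibbs (E i)) l (𝓝 μ)) {T : C(Config d, Config d)}
    (hT : MeasurePreserving T (haarProb (Config d) : Measure (Config d)) (haarProb (Config d)))
    {φ : ι → ι} (hφ : Tendsto φ l l) (hE : ∀ i, (E i).comp T = E (φ i)) :
    MeasurePreserving T (μ : Measure (Config d)) μ := by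
  have hmap (i : ι) : (gibbs (E (φ i))).map T.continuous.aemeasurable = gibbs (E i) := by
    rw [← hE]
    exact ProbabilityMeasure.toMeasure_injective (measurePreserving_gibbs hT (E i)).map_eq
  have hlim := (ProbabilityMeasure.continuous_map T.continuous).continuousAt.tendsto.comp
    (hμ.comp hφ)
  exact ⟨T.continuous.measurable,
    congrArg ProbabilityMeasure.toMeasure (tendsto_nhds_unique (hlim.congr hmap) hμ)⟩

end WeakLimits

section States

variable {d : ℕ} {J : Site d → Site d → ℝ} {β : ℝ} {μ : ProbabilityMeasure (Config d)}

lemma isInfiniteVolumeState_iff {h : ℝ} {τ : Site d → SignType}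
    {E : Finset (Site d) → C(Config d, ℝ)} (hE : ∀ Λ, DependsOn (E Λ) (Λ : Set (Site d)))
    (hEτ : ∀ Λ σ, E Λ (_root_.extend Λ σ) = -β * hamiltonian J h τ Λ σ) :
    IsInfiniteVolumeState J β h τ μ ↔ Tendsto (fun Λ => gibbs (E Λ)) atTop (𝓝 μ) := by
  have hfinite {f : C(Config d, ℝ)} (hf : IsLocal f) :
      (fun Λ => finiteGibbs J β h τ Λ f) =ᶠ[atTop] fun Λ => ∫ σ, f σ ∂(gibbs (E Λ)) := by
    obtain ⟨A, hA⟩ := hf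
    filter_upwards [eventually_ge_atTop A] with Λ hΛ
    exact finiteGibbs_eq_integral_gibbs (hE Λ) (hEτ Λ) (hA.mono (Finset.coe_subset.2 hΛ))
  refine ⟨fun hμ => tendsto_of_forall_tendsto_integral fun f hf =>
    (hμ f hf).congr' (hfinite hf), fun hμ f hf => ?_⟩
  lift f to C(Config d, ℝ) using hf.continuous
  exact (((continuous_integral_continuousMap f).tendsto μ).comp hμ).congr' (hfinite hf).symm

lemma isPlusState_iff :
    IsPlusState J β μ ↔ Tendsto (fun Λ => gibbs (plusEnergy J β Λ)) atTop (𝓝 μ) :=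
  isInfiniteVolumeState_iff (dependsOn_plusEnergy J β) (plusEnergy_extend J β)

lemma isFreeState_iff :
    IsFreeState J β μ ↔ Tendsto (fun Λ => gibbs (freeEnergy J β Λ)) atTop (𝓝 μ) :=
  isInfiniteVolumeState_iff (dependsOn_freeEnergy J β) (freeEnergy_extend J β)

lemma existsUnique_isPlusState (hJ : IsFerromagnetic J) (hβ : 0 ≤ β) :
    ∃! μ : ProbabilityMeasure (Config d), IsPlusState J β μ := by
  classical
  simp only [isPlusState_iff]
  refine existsUnique_of_exists_of_unique
    (exists_tendsto_of_forall_tendsto_integral_plusIndicator fun A => ?_)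
    fun _ _ => tendsto_nhds_unique
  have hanti : Antitone fun Λ => ∫ σ, plusIndicator A σ ∂(gibbs (plusEnergy J β (Λ ∪ A))) :=
    fun Λ Λ' h => integral_gibbs_plusEnergy_anti hJ hβ (Finset.union_subset_union_left h)
      (plusIndicator_mem_posCone A) ((dependsOn_plusIndicator A).mono (by simp))
  have hbdd : BddBelow (Set.range fun Λ =>
      ∫ σ, plusIndicator A σ ∂(gibbs (plusEnergy J β (Λ ∪ A)))) :=
    ⟨0, by rintro _ ⟨Λ, rfl⟩; exact (integral_plusIndicator_pos _ A).le⟩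
  refine ⟨_, (tendsto_atTop_ciInf hanti hbdd).congr' ?_⟩
  filter_upwards [eventually_ge_atTop A] with Λ hΛ
  rw [Finset.union_eq_left.2 hΛ]

lemma existsUnique_isFreeState (hJ : IsFerromagnetic J) (hβ : 0 ≤ β) :
    ∃! μ : ProbabilityMeasure (Config d), IsFreeState J β μ := by
  simp only [isFreeState_iff]
  refine existsUnique_of_exists_of_unique
    (exists_tendsto_of_forall_tendsto_integral_plusIndicator fun A => ?_)
    fun _ _ => tendsto_nhds_unique
  have hmono : Monotone fun Λ => ∫ σ, plusIndicator A σ ∂(gibbs (freeEnergy J β Λ)) :=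
    fun Λ Λ' h => integral_gibbs_bondEnergy_mono (coupling_nonneg hJ hβ)
      (plusIndicator_mem_posCone A) (Finset.product_subset_product h h)
  have hbdd : BddAbove (Set.range fun Λ => ∫ σ, plusIndicator A σ ∂(gibbs (freeEnergy J β Λ))) := by
    refine ⟨‖plusIndicator A‖, ?_⟩
    rintro _ ⟨Λ, rfl⟩
    have hnorm := norm_integral_le_of_norm_le_const
      (μ := gibbs (freeEnergy J β Λ)) (.of_forall (plusIndicator A).norm_coe_le_norm)
    rw [probReal_univ, mul_one] at hnorm
    exact (le_abs_self _).trans hnorm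
  exact ⟨_, tendsto_atTop_ciSup hmono hbdd⟩

lemma tendsto_translateBy (x : Site d) :
    Tendsto (translateBy x : Finset (Site d) → Finset (Site d)) atTop atTop := by
  classical
  refine tendsto_atTop.2 fun Λ => ?_
  filter_upwards [eventually_ge_atTop (translateBy (-x) Λ)] with Λ' h y hy
  refine Finset.mem_map.2 ⟨y - x, h (Finset.mem_map.2 ⟨y, hy, ?_⟩), ?_⟩ <;> simp [sub_eq_add_neg]

lemma IsPlusState.measurePreserving_shift (hJ : IsFerromagnetic J) (hμ : IsPlusState J β μ)
    (x : Site d) : MeasurePreserving (shift x) (μ : Measure (Config d)) μ :=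
  measurePreserving_of_tendsto_gibbs (T := shiftMap x) (isPlusState_iff.1 hμ)
    (measurePreserving_shift_haarProb x) (tendsto_translateBy x) (plusEnergy_comp_shiftMap hJ x)

lemma IsFreeState.measurePreserving_shift (hJ : IsFerromagnetic J) (hμ : IsFreeState J β μ)
    (x : Site d) : MeasurePreserving (shift x) (μ : Measure (Config d)) μ :=
  measurePreserving_of_tendsto_gibbs (T := shiftMap x) (isFreeState_iff.1 hμ)
    (measurePreserving_shift_haarProb x) (tendsto_translateBy x) (freeEnergy_comp_shiftMap hJ x)

lemma freeEnergy_comp_flipMap (Λ : Finset (Site d)) :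
    (freeEnergy J β Λ).comp flipMap = freeEnergy J β Λ := by
  ext σ
  simp [freeEnergy, bondEnergy_apply, flipMap, spin_neg]

lemma IsFreeState.measurePreserving_neg (hμ : IsFreeState J β μ) :
    MeasurePreserving (fun σ : Config d => -σ) (μ : Measure (Config d)) μ :=
  measurePreserving_of_tendsto_gibbs (T := flipMap) (isFreeState_iff.1 hμ)
    measurePreserving_neg_haarProb tendsto_id freeEnergy_comp_flipMap

end States

section Mixing

variable {d : ℕ} {μ : ProbabilityMeasure (Config d)}

lemma atInfinity_eq_cofinite : atInfinity d = cofinite := by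
  rw [atInfinity, comap_norm_atTop, Metric.cobounded_eq_cocompact, cocompact_eq_cofinite]

lemma neBot_atInfinity (hd : 1 ≤ d) : NeBot (atInfinity d) := by
  have : Nonempty (Fin d) := ⟨⟨0, hd⟩⟩
  rw [atInfinity_eq_cofinite]
  infer_instance

lemma eventually_disjoint_translateBy (A B : Finset (Site d)) :
    ∀ᶠ x in atInfinity d, Disjoint A (translateBy x B) := by
  classical
  rw [atInfinity_eq_cofinite]
  refine (Finset.finite_toSet (Finset.image₂ (· - ·) A B)).subset fun x hx => ?_
  obtain ⟨a, ha, hax⟩ := Finset.not_disjoint_iff.1 hx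
  obtain ⟨b, hb, rfl⟩ := Finset.mem_map.1 hax
  exact Finset.mem_image₂.2 ⟨b + x, ha, b, hb, add_sub_cancel_left b x⟩

lemma integral_comp_of_measurePreserving {X Y : Type*} [MeasurableSpace X] [MeasurableSpace Y]
    {μ : Measure X} {ν : Measure Y} {T : X → Y} (hT : MeasurePreserving T μ ν) {g : Y → ℝ}
    (hg : AEStronglyMeasurable g ν) : ∫ x, g (T x) ∂μ = ∫ y, g y ∂ν := by
  rw [← hT.map_eq] at hg
  rw [← integral_map hT.aemeasurable hg, hT.map_eq]

/-- The correlations of `f` with the distant translates of `g` vanish in the limit; `IsMixingFor`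
asks this of all pairs in a class of functions. -/
def Decorrelates (μ : ProbabilityMeasure (Config d)) (f g : Config d → ℝ) : Prop :=
  Tendsto (fun x => ∫ σ, f σ * g (shift x σ) ∂μ) (atInfinity d)
    (𝓝 ((∫ σ, f σ ∂μ) * ∫ σ, g σ ∂μ))

lemma decorrelates_of_mem_span {s : Set C(Config d, ℝ)}
    (hs : ∀ f ∈ s, ∀ g ∈ s, Decorrelates μ f g) {f g : C(Config d, ℝ)}
    (hf : f ∈ Submodule.span ℝ s) (hg : g ∈ Submodule.span ℝ s) : Decorrelates μ f g := by
  have hint (f : C(Config d, ℝ)) := integrable_continuousMap (μ : Measure (Config d)) f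
  have hint' (f g : C(Config d, ℝ)) (x : Site d) := hint (f * g.comp (shiftMap x))
  unfold Decorrelates
  induction hf, hg using Submodule.span_induction₂ with
  | mem_mem f g hf hg => exact hs f hf g hg
  | zero_left g => simpa using tendsto_const_nhds
  | zero_right f => simpa using tendsto_const_nhds
  | add_left f₁ f₂ g _ _ _ h₁ h₂ =>
    simp only [ContinuousMap.add_apply, add_mul]
    rw [integral_add (hint f₁) (hint f₂), add_mul]
    exact (h₁.add h₂).congr fun x => (integral_add (hint' f₁ g x) (hint' f₂ g x)).symm
  | add_right f g₁ g₂ _ _ _ h₁ h₂ =>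
    simp only [ContinuousMap.add_apply, mul_add]
    rw [integral_add (hint g₁) (hint g₂), mul_add]
    exact (h₁.add h₂).congr fun x => (integral_add (hint' f g₁ x) (hint' f g₂ x)).symm
  | smul_left c f g _ _ h =>
    simp only [ContinuousMap.smul_apply, smul_eq_mul, mul_assoc, integral_const_mul]
    exact h.const_mul c
  | smul_right c f g _ _ h =>
    simp only [ContinuousMap.smul_apply, smul_eq_mul, mul_left_comm _ c, integral_const_mul]
    exact h.const_mul c

lemma decorrelates_of_tendsto_gibbs {E : Finset (Site d) → C(Config d, ℝ)}
    (hμ : Tendsto (fun Λ => gibbs (E Λ)) atTop (𝓝 μ))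
    (hinv : ∀ x, MeasurePreserving (shift x) (μ : Measure (Config d)) μ) {f g : C(Config d, ℝ)}
    (hlower : ∀ᶠ x in atInfinity d, ∀ᶠ Λ in atTop,
      (∫ σ, f σ ∂(gibbs (E Λ))) * ∫ σ, g (shift x σ) ∂(gibbs (E Λ)) ≤
        ∫ σ, f σ * g (shift x σ) ∂(gibbs (E Λ)))
    (hupper : ∀ᶠ V in atTop, ∀ᶠ x in atInfinity d, ∀ᶠ Λ in atTop,
      ∫ σ, f σ * g (shift x σ) ∂(gibbs (E Λ)) ≤
        (∫ σ, f σ ∂(gibbs (E Λ))) * ∫ σ, g σ ∂(gibbs (E V))) :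
    Decorrelates μ f g := by
  have hlim (f : C(Config d, ℝ)) :
      Tendsto (fun Λ => ∫ σ, f σ ∂(gibbs (E Λ))) atTop (𝓝 (∫ σ, f σ ∂μ)) :=
    ((continuous_integral_continuousMap f).tendsto μ).comp hμ
  have hmul (x : Site d) := hlim (f * g.comp (shiftMap x))
  refine tendsto_order.2 ⟨fun a ha => ?_, fun a ha => ?_⟩
  · filter_upwards [hlower] with x hx
    rw [← integral_comp_of_measurePreserving (hinv x) g.continuous.aestronglyMeasurable] at ha
    exact ha.trans_le <|
      le_of_tendsto_of_tendsto ((hlim f).mul (hlim (g.comp (shiftMap x)))) (hmul x) hx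
  · obtain ⟨V, hV, hVa⟩ :=
      (hupper.and (((hlim g).const_mul (∫ σ, f σ ∂μ)).eventually (gt_mem_nhds ha))).exists
    filter_upwards [hV] with x hx
    exact (le_of_tendsto_of_tendsto (hmul x) ((hlim f).mul_const _) hx).trans_lt hVa

variable {J : Site d → Site d → ℝ} {β : ℝ}

lemma integral_shift_gibbs {E : Finset (Site d) → C(Config d, ℝ)}
    (hE : ∀ x Λ, (E Λ).comp (shiftMap x) = E (translateBy x Λ)) (x : Site d)
    (Λ : Finset (Site d)) (g : C(Config d, ℝ)) :
    ∫ σ, g (shift x σ) ∂(gibbs (E (translateBy x Λ))) = ∫ σ, g σ ∂(gibbs (E Λ)) := by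
  rw [← hE]
  exact integral_comp_of_measurePreserving
    (measurePreserving_gibbs (T := shiftMap x) (measurePreserving_shift_haarProb x) (E Λ))
    g.continuous.aestronglyMeasurable

lemma IsPlusState.decorrelates_plusIndicator (hJ : IsFerromagnetic J) (hβ : 0 ≤ β)
    (hμ : IsPlusState J β μ) (A B : Finset (Site d)) :
    Decorrelates μ (plusIndicator A) (plusIndicator B) := by
  classical
  have hcomp (x : Site d) (σ : Config d) :
      plusIndicator B (shift x σ) = plusIndicator (translateBy x B) σ :=
    DFunLike.congr_fun (plusIndicator_comp_shiftMap x B) σ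
  refine decorrelates_of_tendsto_gibbs (isPlusState_iff.1 hμ) (hμ.measurePreserving_shift hJ) ?_ ?_
  · refine .of_forall fun x => .of_forall fun Λ => ?_
    simp only [hcomp]
    exact integral_mul_integral_plusIndicator_le (plusEnergy_mem_posCone hJ hβ Λ) A _
  · filter_upwards [eventually_ge_atTop B] with V hBV
    filter_upwards [eventually_disjoint_translateBy A V] with x hx
    filter_upwards [eventually_ge_atTop (A ∪ translateBy x V)] with Λ hΛ
    rw [← integral_shift_gibbs (plusEnergy_comp_shiftMap hJ) x V]
    simp only [hcomp]
    exact integral_plusIndicator_mul_gibbs_le hJ hβ (Finset.union_subset_right hΛ)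
      (Finset.union_subset_left hΛ) hx.symm (plusIndicator_mem_posCone _) <|
      (dependsOn_plusIndicator _).mono (Finset.coe_subset.2 (Finset.map_subset_map.2 hBV))

lemma exists_subset_product_self (S : Finset (Site d × Site d)) :
    ∃ A : Finset (Site d), S ⊆ A ×ˢ A := by
  classical
  refine ⟨S.image Prod.fst ∪ S.image Prod.snd, fun p hp => Finset.mem_product.2 ⟨?_, ?_⟩⟩
  · exact Finset.mem_union_left _ (Finset.mem_image_of_mem _ hp)
  · exact Finset.mem_union_right _ (Finset.mem_image_of_mem _ hp)

lemma IsFreeState.decorrelates_bondRemoval (hJ : IsFerromagnetic J) (hβ : 0 ≤ β)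
    (hμ : IsFreeState J β μ) (S T : Finset (Site d × Site d)) :
    Decorrelates μ (bondRemoval (coupling J β) S) (bondRemoval (coupling J β) T) := by
  classical
  have hK := coupling_nonneg hJ hβ
  have hcomp (x : Site d) (σ : Config d) : bondRemoval (coupling J β) T (shift x σ) =
      bondRemoval (coupling J β) (translateBy (x, x) T) σ :=
    DFunLike.congr_fun (bondRemoval_comp_shiftMap hJ x T) σ
  obtain ⟨A, hSA⟩ := exists_subset_product_self S
  obtain ⟨B, hTB⟩ := exists_subset_product_self T
  have htranslate {V : Finset (Site d)} (hBV : B ⊆ V) (x : Site d) :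
      translateBy (x, x) T ⊆ translateBy x V ×ˢ translateBy x V := by
    rw [← translateBy_product]
    exact Finset.map_subset_map.2 (hTB.trans (Finset.product_subset_product hBV hBV))
  have hdisjoint {V : Finset (Site d)} (hAV : Disjoint A V) : Disjoint S (V ×ˢ V) :=
    (Finset.disjoint_product.2 (.inl hAV)).mono_left hSA
  refine decorrelates_of_tendsto_gibbs (isFreeState_iff.1 hμ) (hμ.measurePreserving_shift hJ) ?_ ?_
  · filter_upwards [eventually_disjoint_translateBy A B] with x hx
    filter_upwards [eventually_ge_atTop (A ∪ translateBy x B)] with Λ hΛ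
    obtain ⟨hAΛ, hBΛ⟩ := Finset.union_subset_iff.1 hΛ
    simp only [hcomp]
    exact integral_mul_integral_bondRemoval_le hK
      ((hdisjoint hx).mono_right (htranslate subset_rfl x))
      (hSA.trans (Finset.product_subset_product hAΛ hAΛ))
      ((htranslate subset_rfl x).trans (Finset.product_subset_product hBΛ hBΛ))
  · filter_upwards [eventually_ge_atTop B] with V hBV
    filter_upwards [eventually_disjoint_translateBy A V] with x hx
    filter_upwards [eventually_ge_atTop (A ∪ translateBy x V)] with Λ hΛ
    obtain ⟨hAΛ, hVΛ⟩ := Finset.union_subset_iff.1 hΛ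
    rw [← integral_shift_gibbs (freeEnergy_comp_shiftMap hJ) x V]
    simp only [hcomp]
    exact integral_bondRemoval_mul_le hK (hSA.trans (Finset.product_subset_product hAΛ hAΛ))
      (htranslate hBV x) (Finset.product_subset_product hVΛ hVΛ) (hdisjoint hx)

lemma IsPlusState.isMixingFor (hJ : IsFerromagnetic J) (hβ : 0 ≤ β) (hμ : IsPlusState J β μ) :
    IsMixingFor μ {F | IsLocal F} := fun F hF G hG => by
  lift F to C(Config d, ℝ) using IsLocal.continuous hF
  lift G to C(Config d, ℝ) using IsLocal.continuous hG
  refine decorrelates_of_mem_span ?_ (mem_span_plusIndicator hF) (mem_span_plusIndicator hG)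
  rintro _ ⟨A, rfl⟩ _ ⟨B, rfl⟩
  exact hμ.decorrelates_plusIndicator hJ hβ A B

lemma isFreeState_zero_iff : IsFreeState J 0 μ ↔ IsPlusState J 0 μ := by
  simp only [isFreeState_iff, isPlusState_iff, plusEnergy, zero_mul, zero_smul,
    Finset.sum_const_zero, add_zero]

/-- The bonds carry no weight at `β = 0`, so that their removals no longer span the even local
functions; but then the free state is also the plus state. -/
lemma IsFreeState.isMixingFor (hJ : IsFerromagnetic J) (hβ : 0 ≤ β) (hμ : IsFreeState J β μ) :
    IsMixingFor μ {F | IsLocal F ∧ IsEven F} := fun F hF G hG => by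
  rcases hβ.eq_or_lt with rfl | hβ'
  · exact (isFreeState_zero_iff.1 hμ).isMixingFor hJ le_rfl F hF.1 G hG.1
  · lift F to C(Config d, ℝ) using hF.1.continuous
    lift G to C(Config d, ℝ) using hG.1.continuous
    refine decorrelates_of_mem_span ?_ (mem_span_bondRemoval hJ hβ'.ne' hF.1 hF.2)
      (mem_span_bondRemoval hJ hβ'.ne' hG.1 hG.2)
    rintro _ ⟨S, rfl⟩ _ ⟨T, rfl⟩
    exact hμ.decorrelates_bondRemoval hJ hβ S T

end Mixing

section Events

open scoped symmDiff

section Measure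

variable {Ω : Type*} [MeasurableSpace Ω] {μ : Measure Ω} {A B A' B' : Set Ω}

lemma abs_measureReal_inter_sub_le [IsFiniteMeasure μ] (hA : NullMeasurableSet A μ)
    (hB : NullMeasurableSet B μ) (hA' : NullMeasurableSet A' μ) (hB' : NullMeasurableSet B' μ) :
    |μ.real (A ∩ B) - μ.real (A' ∩ B')| ≤ μ.real (A ∆ A') + μ.real (B ∆ B') := by
  have hsub : (A ∩ B) ∆ (A' ∩ B') ⊆ A ∆ A' ∪ B ∆ B' := by
    intro ω
    simp only [Set.mem_symmDiff, Set.mem_inter_iff, Set.mem_union]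
    tauto
  exact (abs_measureReal_sub_le_measureReal_symmDiff (hA.inter hB) (hA'.inter hB')).trans <|
    (measureReal_mono hsub).trans (measureReal_union_le _ _)

lemma abs_measureReal_mul_sub_le [IsProbabilityMeasure μ] (hA : NullMeasurableSet A μ)
    (hB : NullMeasurableSet B μ) (hA' : NullMeasurableSet A' μ) (hB' : NullMeasurableSet B' μ) :
    |μ.real A * μ.real B - μ.real A' * μ.real B'| ≤ μ.real (A ∆ A') + μ.real (B ∆ B') :=
  calc |μ.real A * μ.real B - μ.real A' * μ.real B'|
      = |(μ.real A - μ.real A') * μ.real B + μ.real A' * (μ.real B - μ.real B')| := by ring_nf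
    _ ≤ |μ.real A - μ.real A'| * μ.real B + μ.real A' * |μ.real B - μ.real B'| := by
      refine (abs_add_le _ _).trans_eq ?_
      rw [abs_mul, abs_mul, abs_of_nonneg measureReal_nonneg, abs_of_nonneg measureReal_nonneg]
    _ ≤ |μ.real A - μ.real A'| + |μ.real B - μ.real B'| :=
      add_le_add (mul_le_of_le_one_right (abs_nonneg _) measureReal_le_one)
        (mul_le_of_le_one_left (abs_nonneg _) measureReal_le_one)
    _ ≤ μ.real (A ∆ A') + μ.real (B ∆ B') :=
      add_le_add (abs_measureReal_sub_le_measureReal_symmDiff hA hA')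
        (abs_measureReal_sub_le_measureReal_symmDiff hB hB')

end Measure

variable {d : ℕ} {μ : ProbabilityMeasure (Config d)} {𝒜 ℬ : Set (Set (Config d))}

lemma isMixingOn_iff_tendsto_measureReal :
    IsMixingOn μ 𝒜 ↔ ∀ A ∈ 𝒜, ∀ B ∈ 𝒜, Tendsto
      (fun x => (μ : Measure (Config d)).real (A ∩ shift x ⁻¹' B)) (atInfinity d)
      (𝓝 ((μ : Measure (Config d)).real A * (μ : Measure (Config d)).real B)) := by
  refine forall₄_congr fun A _ B _ => ?_
  rw [← ENNReal.tendsto_toReal_iff (fun _ => measure_ne_top _ _)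
    (ENNReal.mul_ne_top (measure_ne_top _ _) (measure_ne_top _ _)), ENNReal.toReal_mul]
  rfl

lemma IsMixingOn.of_approx
    (hinv : ∀ x, MeasurePreserving (shift x) (μ : Measure (Config d)) μ) (hmix : IsMixingOn μ ℬ)
    (h𝒜 : ∀ A ∈ 𝒜, MeasurableSet A) (hℬ : ∀ B ∈ ℬ, MeasurableSet B)
    (happrox : ∀ A ∈ 𝒜, ∀ ε > 0, ∃ B ∈ ℬ, (μ : Measure (Config d)).real (A ∆ B) < ε) :
    IsMixingOn μ 𝒜 := by
  rw [isMixingOn_iff_tendsto_measureReal] at hmix ⊢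
  refine fun A hA B hB => Metric.tendsto_nhds.2 fun ε hε => ?_
  obtain ⟨A', hA', hAA'⟩ := happrox A hA (ε / 5) (by positivity)
  obtain ⟨B', hB', hBB'⟩ := happrox B hB (ε / 5) (by positivity)
  filter_upwards [Metric.tendsto_nhds.1 (hmix A' hA' B' hB') (ε / 5) (by positivity)] with x hx
  have hshift := (hinv x).measureReal_preimage ((h𝒜 B hB).symmDiff (hℬ B' hB')).nullMeasurableSet
  have hinter := abs_measureReal_inter_sub_le (μ := (μ : Measure (Config d)))
    (h𝒜 A hA).nullMeasurableSet ((hinv x).measurable (h𝒜 B hB)).nullMeasurableSet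
    (hℬ A' hA').nullMeasurableSet ((hinv x).measurable (hℬ B' hB')).nullMeasurableSet
  have hmul := abs_measureReal_mul_sub_le (μ := (μ : Measure (Config d)))
    (h𝒜 A hA).nullMeasurableSet (h𝒜 B hB).nullMeasurableSet (hℬ A' hA').nullMeasurableSet
    (hℬ B' hB').nullMeasurableSet
  rw [← Set.preimage_symmDiff, hshift] at hinter
  rw [Real.dist_eq, abs_lt] at hx ⊢
  rw [abs_le] at hinter hmul
  constructor <;> linarith

lemma exists_measurableCylinders_symmDiff_lt (μ : ProbabilityMeasure (Config d))
    {A : Set (Config d)} (hA : MeasurableSet A) {ε : ℝ} (hε : 0 < ε) :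
    ∃ B ∈ measurableCylinders fun _ : Site d => ℤˣ, (μ : Measure (Config d)).real (A ∆ B) < ε := by
  have huniv : {Set.univ} ⊆ measurableCylinders fun _ : Site d => ℤˣ :=
    Set.singleton_subset_iff.2 (univ_mem_measurableCylinders _)
  obtain ⟨B, hB, hBA⟩ := exists_measure_symmDiff_lt_of_generateFrom_isSetRing
    (μ := (μ : Measure (Config d))) isSetRing_measurableCylinders
    ⟨{Set.univ}, Set.countable_singleton _, huniv, by simp⟩
    generateFrom_measurableCylinders.symm hA (ENNReal.ofReal_pos.2 hε)
  rw [symmDiff_comm] at hBA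
  exact ⟨B, hB, (ENNReal.lt_ofReal_iff_toReal_lt (measure_ne_top _ _)).1 hBA⟩

lemma preimage_neg_mem_measurableCylinders {B : Set (Config d)}
    (hB : B ∈ measurableCylinders fun _ : Site d => ℤˣ) :
    Neg.neg ⁻¹' B ∈ measurableCylinders fun _ : Site d => ℤˣ := by
  obtain ⟨Λ, S, -, rfl⟩ := (mem_measurableCylinders _).1 hB
  exact (mem_measurableCylinders _).2 ⟨Λ, Neg.neg ⁻¹' S, .of_discrete, rfl⟩

lemma exists_even_measurableCylinders_symmDiff_lt
    (hneg : MeasurePreserving (fun σ : Config d => -σ) (μ : Measure (Config d)) μ)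
    {A : Set (Config d)} (hA : A ∈ evenEvents d) {ε : ℝ} (hε : 0 < ε) :
    ∃ B ∈ {B | B ∈ measurableCylinders (fun _ : Site d => ℤˣ) ∧ Neg.neg ⁻¹' B = B},
      (μ : Measure (Config d)).real (A ∆ B) < ε := by
  obtain ⟨hAm, hAeven⟩ := MeasurableSpace.measurableSet_invariants.1 hA
  obtain ⟨B, hB, hAB⟩ := exists_measurableCylinders_symmDiff_lt μ hAm (half_pos hε)
  refine ⟨B ∩ Neg.neg ⁻¹' B, ⟨inter_mem_measurableCylinders hB
    (preimage_neg_mem_measurableCylinders hB), ?_⟩, ?_⟩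
  · rw [Set.preimage_inter, ← Set.preimage_comp, neg_comp_neg, Set.preimage_id, Set.inter_comm]
  · have hsub : A ∆ (B ∩ Neg.neg ⁻¹' B) ⊆ A ∆ B ∪ Neg.neg ⁻¹' (A ∆ B) := by
      rw [Set.preimage_symmDiff, show Neg.neg ⁻¹' A = A from hAeven]
      intro σ
      simp only [Set.mem_symmDiff, Set.mem_inter_iff, Set.mem_union]
      tauto
    have hflip : (μ : Measure (Config d)).real (Neg.neg ⁻¹' (A ∆ B)) =
        (μ : Measure (Config d)).real (A ∆ B) :=
      hneg.measureReal_preimage (hAm.symmDiff (.of_mem_measurableCylinders hB)).nullMeasurableSet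
    calc (μ : Measure (Config d)).real (A ∆ (B ∩ Neg.neg ⁻¹' B))
        ≤ (μ : Measure (Config d)).real (A ∆ B) +
            (μ : Measure (Config d)).real (Neg.neg ⁻¹' (A ∆ B)) :=
          (measureReal_mono hsub).trans (measureReal_union_le _ _)
      _ < ε := by linarith

lemma IsMixingFor.isMixingOn {C : Set (Config d → ℝ)} (hmix : IsMixingFor μ C)
    (hmeas : ∀ A ∈ 𝒜, MeasurableSet A) (hC : ∀ A ∈ 𝒜, A.indicator 1 ∈ C) :
    IsMixingOn μ 𝒜 := by
  refine isMixingOn_iff_tendsto_measureReal.2 fun A hA B hB => ?_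
  have hlim := hmix _ (hC A hA) _ (hC B hB)
  rw [integral_indicator_one (hmeas A hA), integral_indicator_one (hmeas B hB)] at hlim
  refine hlim.congr fun x => ?_
  have hpreimage : MeasurableSet (shift x ⁻¹' B) := (shiftMap x).continuous.measurable (hmeas B hB)
  rw [← integral_indicator_one ((hmeas A hA).inter hpreimage), Set.inter_indicator_one]
  rfl

lemma IsMixingFor.isMixingOn_measurableSet (hmix : IsMixingFor μ {F | IsLocal F})
    (hinv : ∀ x, MeasurePreserving (shift x) (μ : Measure (Config d)) μ) :
    IsMixingOn μ {A | MeasurableSet A} := by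
  have hcylinders : IsMixingOn μ (measurableCylinders fun _ : Site d => ℤˣ) := by
    refine hmix.isMixingOn (fun _ => .of_mem_measurableCylinders) fun A hA => ?_
    obtain ⟨Λ, S, -, rfl⟩ := (mem_measurableCylinders _).1 hA
    exact isLocal_indicator_cylinder S
  exact hcylinders.of_approx hinv (fun _ => id) (fun _ => .of_mem_measurableCylinders)
    fun A hA ε hε => exists_measurableCylinders_symmDiff_lt μ hA hε

lemma IsMixingFor.isMixingOn_evenEvents (hmix : IsMixingFor μ {F | IsLocal F ∧ IsEven F})
    (hinv : ∀ x, MeasurePreserving (shift x) (μ : Measure (Config d)) μ)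
    (hneg : MeasurePreserving (fun σ : Config d => -σ) (μ : Measure (Config d)) μ) :
    IsMixingOn μ (evenEvents d) := by
  have hcylinders : IsMixingOn μ
      {B | B ∈ measurableCylinders (fun _ : Site d => ℤˣ) ∧ Neg.neg ⁻¹' B = B} := by
    refine hmix.isMixingOn (fun _ hA => .of_mem_measurableCylinders hA.1) fun A ⟨hA, hAeven⟩ => ?_
    obtain ⟨Λ, S, -, rfl⟩ := (mem_measurableCylinders _).1 hA
    refine ⟨isLocal_indicator_cylinder S, fun σ => ?_⟩
    conv_rhs => rw [← hAeven]
    rfl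
  exact hcylinders.of_approx hinv (fun A hA => (MeasurableSpace.measurableSet_invariants.1 hA).1)
    (fun _ hB => .of_mem_measurableCylinders hB.1)
    fun A hA ε hε => exists_even_measurableCylinders_symmDiff_lt hneg hA hε

lemma IsMixingOn.isErgodicOn (hd : 1 ≤ d) (hmix : IsMixingOn μ 𝒜)
    (hinv : ∀ x, MeasurePreserving (shift x) (μ : Measure (Config d)) μ) : IsErgodicOn μ 𝒜 := by
  refine ⟨hinv, fun A hA hAinv => ?_⟩
  have := neBot_atInfinity hd
  have hlim := hmix A hA A hA
  simp only [hAinv, Set.inter_self] at hlim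
  have hsquare := tendsto_nhds_unique tendsto_const_nhds hlim
  exact or_iff_not_imp_left.2 fun h => (ENNReal.mul_eq_left h (measure_ne_top _ _)).1 hsquare.symm

end Events

theorem propositionA1 (d : ℕ) (hd : 1 ≤ d) (J : Site d → Site d → ℝ) (hJ : IsFerromagnetic J)
    (β : ℝ) (hβ : 0 ≤ β) :
    ((∃! μ : ProbabilityMeasure (Config d), IsPlusState J β μ) ∧
      ∀ μ : ProbabilityMeasure (Config d), IsPlusState J β μ →
        IsMixingFor μ {F | IsLocal F} ∧
        IsMixingOn μ {A | MeasurableSet A} ∧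
        IsErgodicOn μ {A | MeasurableSet A}) ∧
    ((∃! μ : ProbabilityMeasure (Config d), IsFreeState J β μ) ∧
      ∀ μ : ProbabilityMeasure (Config d), IsFreeState J β μ →
        IsMixingFor μ {F | IsLocal F ∧ IsEven F} ∧
        IsMixingOn μ (evenEvents d) ∧
        IsErgodicOn μ (evenEvents d)) := by
  refine ⟨⟨existsUnique_isPlusState hJ hβ, fun μ hμ => ?_⟩,
    existsUnique_isFreeState hJ hβ, fun μ hμ => ?_⟩
  · have hinv := hμ.measurePreserving_shift hJ
    have hmix := hμ.isMixingFor hJ hβ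
    have hevents := hmix.isMixingOn_measurableSet hinv
    exact ⟨hmix, hevents, hevents.isErgodicOn hd hinv⟩
  · have hinv := hμ.measurePreserving_shift hJ
    have hmix := hμ.isMixingFor hJ hβ
    have hevents := hmix.isMixingOn_evenEvents hinv hμ.measurePreserving_neg
    exact ⟨hmix, hevents, hevents.isErgodicOn hd hinv⟩
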